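/- **Language.** Consider first-order formulas built with $\neg,\wedge,\vee,\to,\forall,\exists$ from equations between terms of the language $0,\,s(\cdot),\,+,\,\cdot$ (we write $t'$ for $s(t)$). The free variables are called *parameters* and come in three countably infinite kinds: *active*, *passive* and *internal* parameters. A *sequent* $\Gamma\vdash\Delta$ is a pair of finite multisets of formulas; it is *schematic* if at most one active parameter occurs in it. **The $\mathbf{PA}$-calculus (Takeuti).** It is $\mathbf{LK}$ (logical initial sequents $A\vdash A$, weakening, contraction, cut, and the left and right rules for $\neg,\wedge,\vee,\to,\forall,\exists$; all parameters are treated as ordinary free variables, so any of them may be an eigenvariable), extended by the mathematical initial sequents, for all terms $s,t,r$, $$s'=t'\vdash s=t;\quad s'=0\vdash\;;\quad s=t,\ s=r\vdash t=r;\quad s=t\vdash s'=t';$$ $$\vdash s+0=s;\quad \vdash s+t'=(s+t)';\quad \vdash s\cdot 0=0;\quad \vdash s\cdot t'=s\cdot t+s,$$ and the induction rule $$\frac{F(a),\Gamma\vdash\Delta,F(a')}{F(0),\Gamma\vdash\Delta,F(t)}$$ where $t$ is any term and the parameter $a$ does not occur in $F(0),\Gamma,\Delta$. **The calculus $\mathit{mv}\mathbf{LKIE}$.**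 All sequents of a derivation have to be schematic. The initial sequents are the $A\vdash A$, the mathematical initial sequents above, and the equational ones: $\vdash s=s$; $s=t\vdash s'=t'$; $s_1=t_1,\,s_2=t_2\vdash s_1\circ s_2=t_1\circ t_2$ for $\circ\in\{+,\cdot\}$; $s_1=t_1,\,s_2=t_2,\,s_1=s_2\vdash t_1=t_2$. The rules are those of $\mathbf{LK}$, where in quantifier inferences eigenvariables have to be passive parameters and the terms that are quantified must not contain active or internal parameters; the rule $\mathcal E$, which replaces terms by terms that are equal modulo the equations $s(x)+y=s(x+y)$, $0+y=y$, $s(x)\cdot y=x\cdot y+y$, $0\cdot y=0$; and the multivariate induction rule $$\frac{F(n,\mathbf m_1,\dots,\mathbf m_k),\Gamma\vdash\Delta,F(n',\mathbf m_1,\dots,\mathbf m_k)}{F(0,\mathbf a_1,\dots,\mathbf a_k),\Gamma\vdash\Delta,F(t,\mathbf a_1,\dots,\mathbf a_k)}\;\mathit{mv}\mathbf{IND}$$ where $n$ is an active parameter that does not occur in $F(0,\mathbf m_1,\dots,\mathbf m_k),\Gamma,\Delta$; $t$ and $\mathbf a_1,\dots,\mathbf a_k$ are arbitrary terms; and $\mathbf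 m_1,\dots,\mathbf m_k$ are internal parameters that do not occur in $\Gamma,\Delta$. No strictness condition (preservation of passive parameters) is imposed. A derivation is *$\mathcal E$-free* if it does not use the rule $\mathcal E$. **Theorem.** Let $S$ be a schematic sequent. There is an $\mathcal E$-free $\mathit{mv}\mathbf{LKIE}$-derivation of $S$ if and only if there is a $\mathbf{PA}$-calculus proof of $S$. -/

import Mathlib

namespace PASchema

/-! Terms and formulas of the language `0, ', +, ·, =` of arithmetic.  Free variables are
parameters; bound variables are de Bruijn indices, so that `Tm n` and `Fml n` consist of the terms
and formulas with at most `n` dangling bound variables (index `0` is the innermost one). -/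

/-- The parameters (free variables): active, passive and internal ones, countably many of each. -/
inductive Param : Type
  | active (i : ℕ)
  | passive (i : ℕ)
  | internal (i : ℕ)

/-- Numeric terms. -/
inductive Tm (n : ℕ) : Type
  | param (p : Param) : Tm n
  | bvar (i : Fin n) : Tm n
  | zero : Tm n
  | succ (t : Tm n) : Tm n
  | add (s t : Tm n) : Tm n
  | mul (s t : Tm n) : Tm n

/-- First-order formulas; equality is the only predicate symbol. -/
inductive Fml : ℕ → Type
  | eq {n : ℕ} (s t : Tm n) : Fml n
  | neg {n : ℕ} (A : Fml n) : Fml n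
  | and {n : ℕ} (A B : Fml n) : Fml n
  | or {n : ℕ} (A B : Fml n) : Fml n
  | imp {n : ℕ} (A B : Fml n) : Fml n
  | all {n : ℕ} (A : Fml (n + 1)) : Fml n
  | ex {n : ℕ} (A : Fml (n + 1)) : Fml n

/-- The parameters that occur in a term. -/
def Tm.params {n : ℕ} : Tm n → Set Param
  | .param p => {p}
  | .bvar _ => ∅
  | .zero => ∅
  | .succ t => t.params
  | .add s t => s.params ∪ t.params
  | .mul s t => s.params ∪ t.params

/-- The parameters that occur in a formula. -/
def Fml.params : {n : ℕ} → Fml n → Set Param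
  | _, .eq s t => s.params ∪ t.params
  | _, .neg A => A.params
  | _, .and A B => A.params ∪ B.params
  | _, .or A B => A.params ∪ B.params
  | _, .imp A B => A.params ∪ B.params
  | _, .all A => A.params
  | _, .ex A => A.params

/-- Regard a term as a term under one more binder. -/
def Tm.lift {n : ℕ} : Tm n → Tm (n + 1)
  | .param p => .param p
  | .bvar i => .bvar i.succ
  | .zero => .zero
  | .succ t => .succ t.lift
  | .add s t => .add s.lift t.lift
  | .mul s t => .mul s.lift t.lift

/-- Simultaneous substitution of `ρ` for the parameters and of `σ` for the dangling bound
variables of a term. -/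
def Tm.bind {n m : ℕ} (t : Tm n) (ρ : Param → Tm m) (σ : Fin n → Tm m) : Tm m :=
  match t with
  | .param p => ρ p
  | .bvar i => σ i
  | .zero => .zero
  | .succ t => .succ (t.bind ρ σ)
  | .add s t => .add (s.bind ρ σ) (t.bind ρ σ)
  | .mul s t => .mul (s.bind ρ σ) (t.bind ρ σ)

/-- Simultaneous capture-avoiding substitution of `ρ` for the parameters and of `σ` for the
dangling bound variables of a formula. -/
def Fml.bind : {n m : ℕ} → Fml n → (Param → Tm m) → (Fin n → Tm m) → Fml m
  | _, _, .eq s t, ρ, σ => .eq (s.bind ρ σ) (t.bind ρ σ)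
  | _, _, .neg A, ρ, σ => .neg (A.bind ρ σ)
  | _, _, .and A B, ρ, σ => .and (A.bind ρ σ) (B.bind ρ σ)
  | _, _, .or A B, ρ, σ => .or (A.bind ρ σ) (B.bind ρ σ)
  | _, _, .imp A B, ρ, σ => .imp (A.bind ρ σ) (B.bind ρ σ)
  | _, _, .all A, ρ, σ =>
      .all (A.bind (fun p => (ρ p).lift) (Fin.cases (.bvar 0) (fun i => (σ i).lift)))
  | _, _, .ex A, ρ, σ =>
      .ex (A.bind (fun p => (ρ p).lift) (Fin.cases (.bvar 0) (fun i => (σ i).lift)))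

/-- `F(t)`, for a formula `F(x)` with one dangling variable `x`; parameters stay as they are. -/
def Fml.inst (F : Fml 1) (t : Tm 0) : Fml 0 :=
  F.bind Tm.param (fun _ => t)

/-- The parameters that occur in a multiset of formulas. -/
def ctxParams (Γ : Multiset (Fml 0)) : Set Param :=
  {p | ∃ A ∈ Γ, p ∈ A.params}

/-- A sequent `ante ⊢ succ` is a pair of finite multisets of (closed up to parameters) formulas. -/
structure Sequent : Type where
  ante : Multiset (Fml 0)
  succ : Multiset (Fml 0)

/-- The parameters that occur in a sequent. -/
def Sequent.params (S : Sequent) : Set Param :=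
  ctxParams S.ante ∪ ctxParams S.succ

/-- A schematic sequent contains at most one active parameter (there is no restriction on passive
and internal parameters). -/
def Sequent.IsSchematic (S : Sequent) : Prop :=
  ∀ i j : ℕ, Param.active i ∈ S.params → Param.active j ∈ S.params → i = j

/-- All parameters of the term are passive (ground terms are included). -/
def Tm.IsPassive (t : Tm 0) : Prop :=
  ∀ p ∈ t.params, ∃ i : ℕ, p = Param.passive i

/-- One inference `premises / conclusion` of Gentzen's calculus **LK** on multiset sequents (so
exchange is built in).  `Eigen` says which parameters may be eigenvariables of strong quantifier
inferences, and `Inst` which terms may be quantified by weak quantifier inferences; in plain **LK**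
both hold always. -/
inductive LKStep (Eigen : Param → Prop) (Inst : Tm 0 → Prop) : List Sequent → Sequent → Prop
  | weakL (A : Fml 0) (Γ Δ : Multiset (Fml 0)) :
      LKStep Eigen Inst [⟨Γ, Δ⟩] ⟨A ::ₘ Γ, Δ⟩
  | weakR (A : Fml 0) (Γ Δ : Multiset (Fml 0)) :
      LKStep Eigen Inst [⟨Γ, Δ⟩] ⟨Γ, A ::ₘ Δ⟩
  | contrL (A : Fml 0) (Γ Δ : Multiset (Fml 0)) :
      LKStep Eigen Inst [⟨A ::ₘ A ::ₘ Γ, Δ⟩] ⟨A ::ₘ Γ, Δ⟩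
  | contrR (A : Fml 0) (Γ Δ : Multiset (Fml 0)) :
      LKStep Eigen Inst [⟨Γ, A ::ₘ A ::ₘ Δ⟩] ⟨Γ, A ::ₘ Δ⟩
  | cut (A : Fml 0) (Γ Δ Θ Λ : Multiset (Fml 0)) :
      LKStep Eigen Inst [⟨Γ, A ::ₘ Δ⟩, ⟨A ::ₘ Θ, Λ⟩] ⟨Γ + Θ, Δ + Λ⟩
  | negL (A : Fml 0) (Γ Δ : Multiset (Fml 0)) :
      LKStep Eigen Inst [⟨Γ, A ::ₘ Δ⟩] ⟨A.neg ::ₘ Γ, Δ⟩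
  | negR (A : Fml 0) (Γ Δ : Multiset (Fml 0)) :
      LKStep Eigen Inst [⟨A ::ₘ Γ, Δ⟩] ⟨Γ, A.neg ::ₘ Δ⟩
  | andL₁ (A B : Fml 0) (Γ Δ : Multiset (Fml 0)) :
      LKStep Eigen Inst [⟨A ::ₘ Γ, Δ⟩] ⟨A.and B ::ₘ Γ, Δ⟩
  | andL₂ (A B : Fml 0) (Γ Δ : Multiset (Fml 0)) :
      LKStep Eigen Inst [⟨B ::ₘ Γ, Δ⟩] ⟨A.and B ::ₘ Γ, Δ⟩
  | andR (A B : Fml 0) (Γ Δ : Multiset (Fml 0)) :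
      LKStep Eigen Inst [⟨Γ, A ::ₘ Δ⟩, ⟨Γ, B ::ₘ Δ⟩] ⟨Γ, A.and B ::ₘ Δ⟩
  | orL (A B : Fml 0) (Γ Δ : Multiset (Fml 0)) :
      LKStep Eigen Inst [⟨A ::ₘ Γ, Δ⟩, ⟨B ::ₘ Γ, Δ⟩] ⟨A.or B ::ₘ Γ, Δ⟩
  | orR₁ (A B : Fml 0) (Γ Δ : Multiset (Fml 0)) :
      LKStep Eigen Inst [⟨Γ, A ::ₘ Δ⟩] ⟨Γ, A.or B ::ₘ Δ⟩
  | orR₂ (A B : Fml 0) (Γ Δ : Multiset (Fml 0)) :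
      LKStep Eigen Inst [⟨Γ, B ::ₘ Δ⟩] ⟨Γ, A.or B ::ₘ Δ⟩
  | impL (A B : Fml 0) (Γ Δ Θ Λ : Multiset (Fml 0)) :
      LKStep Eigen Inst [⟨Γ, A ::ₘ Δ⟩, ⟨B ::ₘ Θ, Λ⟩] ⟨A.imp B ::ₘ (Γ + Θ), Δ + Λ⟩
  | impR (A B : Fml 0) (Γ Δ : Multiset (Fml 0)) :
      LKStep Eigen Inst [⟨A ::ₘ Γ, B ::ₘ Δ⟩] ⟨Γ, A.imp B ::ₘ Δ⟩
  | allL (F : Fml 1) (t : Tm 0) (Γ Δ : Multiset (Fml 0)) (ht : Inst t) :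
      LKStep Eigen Inst [⟨F.inst t ::ₘ Γ, Δ⟩] ⟨F.all ::ₘ Γ, Δ⟩
  | allR (F : Fml 1) (p : Param) (Γ Δ : Multiset (Fml 0)) (hp : Eigen p)
      (hF : p ∉ F.params) (hΓ : p ∉ ctxParams Γ) (hΔ : p ∉ ctxParams Δ) :
      LKStep Eigen Inst [⟨Γ, F.inst (.param p) ::ₘ Δ⟩] ⟨Γ, F.all ::ₘ Δ⟩
  | exL (F : Fml 1) (p : Param) (Γ Δ : Multiset (Fml 0)) (hp : Eigen p)
      (hF : p ∉ F.params) (hΓ : p ∉ ctxParams Γ) (hΔ : p ∉ ctxParams Δ) :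
      LKStep Eigen Inst [⟨F.inst (.param p) ::ₘ Γ, Δ⟩] ⟨F.ex ::ₘ Γ, Δ⟩
  | exR (F : Fml 1) (t : Tm 0) (Γ Δ : Multiset (Fml 0)) (ht : Inst t) :
      LKStep Eigen Inst [⟨Γ, F.inst t ::ₘ Δ⟩] ⟨Γ, F.ex ::ₘ Δ⟩

/-- The mathematical initial sequents of Takeuti's system of Peano arithmetic. -/
inductive PAInit : Sequent → Prop
  | succ_inj (s t : Tm 0) : PAInit ⟨{.eq s.succ t.succ}, {.eq s t}⟩
  | succ_ne_zero (s : Tm 0) : PAInit ⟨{.eq s.succ .zero}, 0⟩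
  | eq_trans (s t r : Tm 0) : PAInit ⟨{.eq s t, .eq s r}, {.eq t r}⟩
  | eq_succ (s t : Tm 0) : PAInit ⟨{.eq s t}, {.eq s.succ t.succ}⟩
  | add_zero (s : Tm 0) : PAInit ⟨0, {.eq (.add s .zero) s}⟩
  | add_succ (s t : Tm 0) : PAInit ⟨0, {.eq (.add s t.succ) (Tm.add s t).succ}⟩
  | mul_zero (s : Tm 0) : PAInit ⟨0, {.eq (.mul s .zero) .zero}⟩
  | mul_succ (s t : Tm 0) : PAInit ⟨0, {.eq (.mul s t.succ) (.add (.mul s t) s)}⟩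

/-- The equational initial sequents of the calculus **LK**ₑ (reflexivity and substitutivity for
the function symbols and the predicate symbol) in the language of arithmetic. -/
inductive EqInit : Sequent → Prop
  | refl (s : Tm 0) : EqInit ⟨0, {.eq s s}⟩
  | succ (s t : Tm 0) : EqInit ⟨{.eq s t}, {.eq s.succ t.succ}⟩
  | add (s₁ s₂ t₁ t₂ : Tm 0) :
      EqInit ⟨{.eq s₁ t₁, .eq s₂ t₂}, {.eq (.add s₁ s₂) (.add t₁ t₂)}⟩
  | mul (s₁ s₂ t₁ t₂ : Tm 0) :
      EqInit ⟨{.eq s₁ t₁, .eq s₂ t₂}, {.eq (.mul s₁ s₂) (.mul t₁ t₂)}⟩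
  | eq (s₁ s₂ t₁ t₂ : Tm 0) :
      EqInit ⟨{.eq s₁ t₁, .eq s₂ t₂, .eq s₁ s₂}, {.eq t₁ t₂}⟩

/-- Proofs in Takeuti's **PA**-calculus: **LK** with the mathematical initial sequents and the
induction rule `F(a), Γ ⊢ Δ, F(a') / F(0), Γ ⊢ Δ, F(t)` with eigenvariable `a` and arbitrary `t`.
All parameters, whatever their kind, are ordinary free variables here. -/
inductive PAProof : Sequent → Type
  | logical (A : Fml 0) : PAProof ⟨{A}, {A}⟩
  | init {S : Sequent} (h : PAInit S) : PAProof S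
  | lk {Ps : List Sequent} {S : Sequent} (h : LKStep (fun _ => True) (fun _ => True) Ps S)
      (d : ∀ P ∈ Ps, PAProof P) : PAProof S
  | ind (F : Fml 1) (a : Param) (t : Tm 0) (Γ Δ : Multiset (Fml 0))
      (hF : a ∉ F.params) (hΓ : a ∉ ctxParams Γ) (hΔ : a ∉ ctxParams Δ)
      (d : PAProof ⟨F.inst (.param a) ::ₘ Γ, F.inst (Tm.succ (.param a)) ::ₘ Δ⟩) :
      PAProof ⟨F.inst .zero ::ₘ Γ, F.inst t ::ₘ Δ⟩

/-- Equality of terms modulo the equational theory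
`a(s(x), y) = s(a(x, y)), a(0, y) = y, m(s(x), y) = a(m(x, y), y), m(0, y) = 0`. -/
inductive TmEqE {n : ℕ} : Tm n → Tm n → Prop
  | refl (t : Tm n) : TmEqE t t
  | symm {s t : Tm n} (h : TmEqE s t) : TmEqE t s
  | trans {s t r : Tm n} (h : TmEqE s t) (h' : TmEqE t r) : TmEqE s r
  | succ {s t : Tm n} (h : TmEqE s t) : TmEqE s.succ t.succ
  | add {s₁ s₂ t₁ t₂ : Tm n} (h₁ : TmEqE s₁ t₁) (h₂ : TmEqE s₂ t₂) :
      TmEqE (.add s₁ s₂) (.add t₁ t₂)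
  | mul {s₁ s₂ t₁ t₂ : Tm n} (h₁ : TmEqE s₁ t₁) (h₂ : TmEqE s₂ t₂) :
      TmEqE (.mul s₁ s₂) (.mul t₁ t₂)
  | succ_add (x y : Tm n) : TmEqE (.add x.succ y) (Tm.add x y).succ
  | zero_add (y : Tm n) : TmEqE (.add .zero y) y
  | succ_mul (x y : Tm n) : TmEqE (.mul x.succ y) (.add (.mul x y) y)
  | zero_mul (y : Tm n) : TmEqE (.mul .zero y) .zero

/-- Equality of formulas modulo the equational theory: one arises from the other by replacing
terms by equal terms. -/
inductive FmlEqE : {n : ℕ} → Fml n → Fml n → Prop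
  | eq {n : ℕ} {s₁ s₂ t₁ t₂ : Tm n} (h₁ : TmEqE s₁ t₁) (h₂ : TmEqE s₂ t₂) :
      FmlEqE (.eq s₁ s₂) (.eq t₁ t₂)
  | neg {n : ℕ} {A A' : Fml n} (h : FmlEqE A A') : FmlEqE A.neg A'.neg
  | and {n : ℕ} {A A' B B' : Fml n} (hA : FmlEqE A A') (hB : FmlEqE B B') :
      FmlEqE (A.and B) (A'.and B')
  | or {n : ℕ} {A A' B B' : Fml n} (hA : FmlEqE A A') (hB : FmlEqE B B') :
      FmlEqE (A.or B) (A'.or B')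
  | imp {n : ℕ} {A A' B B' : Fml n} (hA : FmlEqE A A') (hB : FmlEqE B B') :
      FmlEqE (A.imp B) (A'.imp B')
  | all {n : ℕ} {A A' : Fml (n + 1)} (h : FmlEqE A A') : FmlEqE A.all A'.all
  | ex {n : ℕ} {A A' : Fml (n + 1)} (h : FmlEqE A A') : FmlEqE A.ex A'.ex

/-- The instantiation of the internal parameters by `σ`; all other parameters stay. -/
def internalInst (σ : ℕ → Tm 0) : Param → Tm 0
  | .internal i => σ i
  | p => .param p

/-- Derivations in the calculus *mv***LKIE**.  Every sequent in a derivation is schematic; only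
passive parameters are eigenvariables of quantifier inferences, and no term with an active or
internal parameter is quantified.  In `mvInd` the active parameter `n` is the induction variable,
`t` is any term, and `σ` instantiates the internal parameters of the induction formula; an
internal parameter that occurs in the side formulas `Γ`, `Δ` has to be left as it is. -/
inductive MvLKIE : Sequent → Type
  | logical (A : Fml 0) (hS : Sequent.IsSchematic ⟨{A}, {A}⟩) : MvLKIE ⟨{A}, {A}⟩
  | init {S : Sequent} (hS : S.IsSchematic) (h : PAInit S ∨ EqInit S) : MvLKIE S
  | lk {Ps : List Sequent} {S : Sequent} (hS : S.IsSchematic)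
      (h : LKStep (fun p => ∃ i : ℕ, p = Param.passive i) Tm.IsPassive Ps S)
      (d : ∀ P ∈ Ps, MvLKIE P) : MvLKIE S
  | mvInd (F : Fml 1) (n : ℕ) (σ : ℕ → Tm 0) (t : Tm 0) (Γ Δ : Multiset (Fml 0))
      (hS : Sequent.IsSchematic
        ⟨F.bind (internalInst σ) (fun _ => .zero) ::ₘ Γ,
          F.bind (internalInst σ) (fun _ => t) ::ₘ Δ⟩)
      (hF : Param.active n ∉ F.params)
      (hΓ : Param.active n ∉ ctxParams Γ) (hΔ : Param.active n ∉ ctxParams Δ)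
      (hσ : ∀ i : ℕ, Param.internal i ∈ ctxParams Γ ∪ ctxParams Δ → σ i = .param (.internal i))
      (d : MvLKIE ⟨F.inst (.param (.active n)) ::ₘ Γ,
        F.inst (Tm.succ (.param (.active n))) ::ₘ Δ⟩) :
      MvLKIE ⟨F.bind (internalInst σ) (fun _ => .zero) ::ₘ Γ,
        F.bind (internalInst σ) (fun _ => t) ::ₘ Δ⟩
  | eqE {S S' : Sequent} (hS : S'.IsSchematic)
      (hante : Multiset.Rel FmlEqE S.ante S'.ante) (hsucc : Multiset.Rel FmlEqE S.succ S'.succ)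
      (d : MvLKIE S) : MvLKIE S'

/-- The derivation does not use the inference rule of the equational theory. -/
def MvLKIE.EFree : {S : Sequent} → MvLKIE S → Prop
  | _, .logical _ _ => True
  | _, .init _ _ => True
  | _, .lk _ _ d => ∀ P hP, (d P hP).EFree
  | _, .mvInd _ _ _ _ _ _ _ _ _ _ _ d => d.EFree
  | _, .eqE _ _ _ _ => False

end PASchema

namespace PASchema

open Function

/-! From *mv***LKIE** to **PA**: the equational initial sequents follow from the recursion equations
by induction (`PA.of_eqInit`). Proofs in **PA** are closed under substitution for parameters
(`PA.subst`), so an *mv***IND** inference becomes ordinary induction once its internal parameters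
are instantiated and its active parameter is renamed in the proof of the premise (`PA.mvInd`).

From **PA** to *mv***LKIE**: the obstacle is that quantifiers see only passive parameters while
induction runs only over an active one, and only one active parameter is allowed. The bridge is that
`∃ x, x = t` is derivable for every admissible `t`, by induction (`Mv.ex_eq`), although `t` itself
may not be quantified. With Leibniz's law (`Mv.bind_imp_bind`) and cut, a fresh passive parameter in
a derivable sequent can then be replaced by any admissible term (`Mv.subst_of_update`).

A **PA**-proof is therefore translated with all parameters replaced by passive terms
(`Mv.passive_subst`). At an induction the eigenvariable is first a fresh passive parameter, which is
exchanged for the active one just before the rule is applied. At the end the original parameters of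
the sequent are put back one at a time (`Mv.of_PA`). Only the identical instantiation of internal
parameters is needed. -/

theorem exists_fresh_passive {s : Set Param} (hs : s.Finite) : ∃ i, Param.passive i ∉ s := by
  have h : (Set.range Param.passive).Infinite :=
    Set.infinite_range_of_injective fun _ _ h => Param.passive.inj h
  obtain ⟨_, ⟨i, rfl⟩, hi⟩ := (h.sdiff hs).nonempty
  exact ⟨i, hi⟩

/-! ### Substitution calculus for terms and formulas. -/

namespace Tm

variable {n m k : ℕ}

theorem lift_bind (t : Tm n) (ρ : Param → Tm m) (σ : Fin (n + 1) → Tm m) :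
    t.lift.bind ρ σ = t.bind ρ (fun i => σ i.succ) := by
  induction t <;> simp_all [lift, bind]

theorem bind_lift (t : Tm n) (ρ : Param → Tm m) (σ : Fin n → Tm m) :
    (t.bind ρ σ).lift = t.bind (fun p => (ρ p).lift) (fun i => (σ i).lift) := by
  induction t <;> simp_all [lift, bind]

theorem bind_bind (t : Tm n) (ρ : Param → Tm m) (σ : Fin n → Tm m) (ρ' : Param → Tm k)
    (σ' : Fin m → Tm k) :
    (t.bind ρ σ).bind ρ' σ' =
      t.bind (fun p => (ρ p).bind ρ' σ') (fun i => (σ i).bind ρ' σ') := by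
  induction t <;> simp_all [bind]

theorem bind_id (t : Tm n) : t.bind param bvar = t := by
  induction t <;> simp_all [bind]

theorem bind_congr {t : Tm n} {ρ ρ' : Param → Tm m} (σ : Fin n → Tm m)
    (h : ∀ p ∈ t.params, ρ p = ρ' p) : t.bind ρ σ = t.bind ρ' σ := by
  induction t <;> simp_all [bind, params]

theorem params_lift (t : Tm n) : t.lift.params = t.params := by
  induction t <;> simp_all [lift, params]

theorem mem_params_bind {t : Tm n} {ρ : Param → Tm m} {σ : Fin n → Tm m} {p : Param}
    (h : p ∈ (t.bind ρ σ).params) :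
    (∃ q ∈ t.params, p ∈ (ρ q).params) ∨ ∃ i, p ∈ (σ i).params := by
  induction t with
  | param q => exact .inl ⟨q, rfl, h⟩
  | bvar i => exact .inr ⟨i, h⟩
  | zero => exact h.elim
  | succ t ih => exact ih h
  | add s t ihs iht | mul s t ihs iht =>
    rcases h with h | h
    · exact (ihs h).imp_left fun ⟨q, hq, hp⟩ => ⟨q, .inl hq, hp⟩
    · exact (iht h).imp_left fun ⟨q, hq, hp⟩ => ⟨q, .inr hq, hp⟩

theorem finite_params (t : Tm n) : t.params.Finite := by
  induction t <;> simp_all [params]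

end Tm

namespace Fml

variable {n m k : ℕ}

theorem bind_bind (A : Fml n) (ρ : Param → Tm m) (σ : Fin n → Tm m) (ρ' : Param → Tm k)
    (σ' : Fin m → Tm k) :
    (A.bind ρ σ).bind ρ' σ' =
      A.bind (fun p => (ρ p).bind ρ' σ') (fun i => (σ i).bind ρ' σ') := by
  induction A generalizing m k with
  | eq s t => simp [bind, Tm.bind_bind]
  | neg A ih => simp [bind, ih]
  | and A B ihA ihB | or A B ihA ihB | imp A B ihA ihB => simp [bind, ihA, ihB]
  | all A ih | ex A ih =>
    simp only [bind, ih, Tm.lift_bind, Tm.bind_lift, Fin.cases_succ]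
    congr 2
    funext i
    cases i using Fin.cases <;> simp [Tm.bind, Tm.lift_bind]

theorem cases_bvar :
    (Fin.cases (.bvar 0) (fun i => (Tm.bvar i).lift) : Fin (n + 1) → Tm (n + 1)) = Tm.bvar := by
  funext i
  cases i using Fin.cases <;> rfl

theorem bind_id (A : Fml n) : A.bind Tm.param Tm.bvar = A := by
  induction A with
  | eq s t => simp [bind, Tm.bind_id]
  | neg A ih => simp [bind, ih]
  | and A B ihA ihB | or A B ihA ihB | imp A B ihA ihB => simp [bind, ihA, ihB]
  | all A ih => exact congrArg Fml.all ((congrArg _ cases_bvar).trans ih)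
  | ex A ih => exact congrArg Fml.ex ((congrArg _ cases_bvar).trans ih)

theorem bind_congr {A : Fml n} {ρ ρ' : Param → Tm m} (σ : Fin n → Tm m)
    (h : ∀ p ∈ A.params, ρ p = ρ' p) : A.bind ρ σ = A.bind ρ' σ := by
  induction A generalizing m with
  | eq s t =>
    simp only [bind]
    rw [Tm.bind_congr σ fun p hp => h p (.inl hp), Tm.bind_congr σ fun p hp => h p (.inr hp)]
  | neg A ih => simp only [bind, ih σ h]
  | and A B ihA ihB | or A B ihA ihB | imp A B ihA ihB =>
    simp only [bind]
    rw [ihA σ fun p hp => h p (.inl hp), ihB σ fun p hp => h p (.inr hp)]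
  | all A ih | ex A ih =>
    simp only [bind]
    rw [ih _ fun p hp => congrArg Tm.lift (h p hp)]

theorem mem_params_bind {A : Fml n} {ρ : Param → Tm m} {σ : Fin n → Tm m} {p : Param}
    (h : p ∈ (A.bind ρ σ).params) :
    (∃ q ∈ A.params, p ∈ (ρ q).params) ∨ ∃ i, p ∈ (σ i).params := by
  induction A generalizing m with
  | eq s t =>
    rcases h with h | h
    · exact (Tm.mem_params_bind h).imp_left fun ⟨q, hq, hp⟩ => ⟨q, .inl hq, hp⟩
    · exact (Tm.mem_params_bind h).imp_left fun ⟨q, hq, hp⟩ => ⟨q, .inr hq, hp⟩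
  | neg A ih => exact ih h
  | and A B ihA ihB | or A B ihA ihB | imp A B ihA ihB =>
    rcases h with h | h
    · exact (ihA h).imp_left fun ⟨q, hq, hp⟩ => ⟨q, .inl hq, hp⟩
    · exact (ihB h).imp_left fun ⟨q, hq, hp⟩ => ⟨q, .inr hq, hp⟩
  | all A ih | ex A ih =>
    rcases ih h with ⟨q, hq, hp⟩ | ⟨i, hi⟩
    · exact .inl ⟨q, hq, by rwa [Tm.params_lift] at hp⟩
    · cases i using Fin.cases with
      | zero => exact hi.elim
      | succ i => exact .inr ⟨i, by simpa [Tm.params_lift] using hi⟩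

theorem finite_params (A : Fml n) : A.params.Finite := by
  induction A with
  | eq s t => exact s.finite_params.union t.finite_params
  | neg A ih | all A ih | ex A ih => exact ih
  | and A B ihA ihB | or A B ihA ihB | imp A B ihA ihB => exact ihA.union ihB

/-- Substitution for the parameters of a formula without dangling variables. -/
abbrev subst (A : Fml 0) (ρ : Param → Tm 0) : Fml 0 := A.bind ρ Tm.bvar

/-- Substitution for the parameters of a formula with one dangling variable. -/
abbrev subst₁ (F : Fml 1) (ρ : Param → Tm 0) : Fml 1 := F.bind (fun p => (ρ p).lift) Tm.bvar

theorem subst_all (F : Fml 1) (ρ : Param → Tm 0) : F.all.subst ρ = (F.subst₁ ρ).all := by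
  simp only [subst, bind, cases_bvar]

theorem subst_ex (F : Fml 1) (ρ : Param → Tm 0) : F.ex.subst ρ = (F.subst₁ ρ).ex := by
  simp only [subst, bind, cases_bvar]

/-- Exhibits the formulas in the conclusion of *mv***IND** as instances of a single substituted
formula, the form that ordinary induction requires. -/
theorem inst_subst₁ (F : Fml 1) (ρ : Param → Tm 0) (t : Tm 0) :
    (F.subst₁ ρ).inst t = F.bind ρ (fun _ => t) := by
  have h : ∀ s : Tm 0, s.bind Tm.param (fun _ => t) = s := fun s => by
    rw [Subsingleton.elim (fun i : Fin 0 => t) Tm.bvar, Tm.bind_id]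
  simp [inst, subst₁, bind_bind, Tm.lift_bind, Tm.bind, h]

theorem inst_subst (F : Fml 1) (ρ : Param → Tm 0) (t : Tm 0) :
    (F.inst t).subst ρ = (F.subst₁ ρ).inst (t.bind ρ Tm.bvar) := by
  rw [inst_subst₁, inst, subst, bind_bind]
  rfl

theorem mem_params_subst₁ {F : Fml 1} {ρ : Param → Tm 0} {p : Param}
    (h : p ∈ (F.subst₁ ρ).params) : ∃ q ∈ F.params, p ∈ (ρ q).params := by
  rcases mem_params_bind h with ⟨q, hq, hp⟩ | ⟨_, hi⟩
  · exact ⟨q, hq, by rwa [Tm.params_lift] at hp⟩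
  · exact hi.elim

theorem mem_params_subst {A : Fml 0} {ρ : Param → Tm 0} {p : Param}
    (h : p ∈ (A.subst ρ).params) : ∃ q ∈ A.params, p ∈ (ρ q).params :=
  (mem_params_bind h).resolve_right fun ⟨i, _⟩ => i.elim0

theorem mem_params_inst {F : Fml 1} {t : Tm 0} {p : Param}
    (h : p ∈ (F.inst t).params) : p ∈ F.params ∨ p ∈ t.params := by
  rcases mem_params_bind h with ⟨q, hq, rfl⟩ | ⟨_, hi⟩
  · exact .inl hq
  · exact .inr hi

/-- Parameters are mapped to themselves, so none is lost. This bounds the parameters of an induction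
formula by those of a derivable premise. -/
theorem params_subset_inst (F : Fml 1) (t : Tm 0) : F.params ⊆ (F.inst t).params := by
  have hT : ∀ {n m : ℕ} (s : Tm n) (ρ : Param → Tm m) (σ : Fin n → Tm m),
      (∀ p, (ρ p).params = {p}) → s.params ⊆ (s.bind ρ σ).params := by
    intro n m s ρ σ h
    induction s with
    | param p => exact (h p).ge
    | bvar i => exact Set.empty_subset _
    | zero => exact subset_rfl
    | succ t ih => exact ih
    | add s t ihs iht | mul s t ihs iht => exact Set.union_subset_union ihs iht
  have hF : ∀ {n m : ℕ} (A : Fml n) (ρ : Param → Tm m) (σ : Fin n → Tm m),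
      (∀ p, (ρ p).params = {p}) → A.params ⊆ (A.bind ρ σ).params := by
    intro n m A ρ σ h
    induction A generalizing m with
    | eq s t => exact Set.union_subset_union (hT s ρ σ h) (hT t ρ σ h)
    | neg A ih => exact ih ρ σ h
    | and A B ihA ihB | or A B ihA ihB | imp A B ihA ihB =>
      exact Set.union_subset_union (ihA ρ σ h) (ihB ρ σ h)
    | all A ih | ex A ih => exact ih _ _ fun p => by rw [Tm.params_lift, h]
  exact hF F _ _ fun _ => rfl

end Fml

/-! ### Parameters and substitution for contexts and sequents. -/

theorem ctxParams_zero : ctxParams 0 = ∅ := by simp [ctxParams]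

theorem ctxParams_cons (A : Fml 0) (Γ : Multiset (Fml 0)) :
    ctxParams (A ::ₘ Γ) = A.params ∪ ctxParams Γ := by
  ext; simp [ctxParams]

theorem ctxParams_singleton (A : Fml 0) : ctxParams {A} = A.params := by
  ext; simp [ctxParams]

theorem ctxParams_add (Γ Δ : Multiset (Fml 0)) :
    ctxParams (Γ + Δ) = ctxParams Γ ∪ ctxParams Δ := by
  ext; simp [ctxParams, or_and_right, exists_or]

theorem finite_ctxParams (Γ : Multiset (Fml 0)) : (ctxParams Γ).Finite := by
  induction Γ using Multiset.induction_on with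
  | empty => simp [ctxParams_zero]
  | cons A Γ ih => rw [ctxParams_cons]; exact A.finite_params.union ih

theorem Sequent.finite_params (S : Sequent) : S.params.Finite :=
  (finite_ctxParams _).union (finite_ctxParams _)

/-- Substitution for the parameters of a multiset of formulas. -/
def ctxSubst (ρ : Param → Tm 0) (Γ : Multiset (Fml 0)) : Multiset (Fml 0) :=
  Γ.map fun A => A.subst ρ

theorem ctxSubst_cons (ρ : Param → Tm 0) (A : Fml 0) (Γ : Multiset (Fml 0)) :
    ctxSubst ρ (A ::ₘ Γ) = A.subst ρ ::ₘ ctxSubst ρ Γ :=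
  Multiset.map_cons _ _ _

theorem ctxSubst_add (ρ : Param → Tm 0) (Γ Δ : Multiset (Fml 0)) :
    ctxSubst ρ (Γ + Δ) = ctxSubst ρ Γ + ctxSubst ρ Δ :=
  Multiset.map_add _ _ _

theorem ctxSubst_congr {ρ ρ' : Param → Tm 0} {Γ : Multiset (Fml 0)}
    (h : ∀ p ∈ ctxParams Γ, ρ p = ρ' p) : ctxSubst ρ Γ = ctxSubst ρ' Γ :=
  Multiset.map_congr rfl fun A hA => Fml.bind_congr _ fun p hp => h p ⟨A, hA, hp⟩

theorem ctxSubst_id (Γ : Multiset (Fml 0)) : ctxSubst Tm.param Γ = Γ := by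
  simp [ctxSubst, Fml.subst, Fml.bind_id]

theorem mem_ctxParams_subst {ρ : Param → Tm 0} {Γ : Multiset (Fml 0)} {p : Param}
    (h : p ∈ ctxParams (ctxSubst ρ Γ)) : ∃ q ∈ ctxParams Γ, p ∈ (ρ q).params := by
  obtain ⟨B, hB, hp⟩ := h
  obtain ⟨A, hA, rfl⟩ := Multiset.mem_map.1 hB
  obtain ⟨q, hq, hpq⟩ := Fml.mem_params_subst hp
  exact ⟨q, ⟨A, hA, hq⟩, hpq⟩

/-- Substitution for the parameters of a sequent. -/
def Sequent.subst (S : Sequent) (ρ : Param → Tm 0) : Sequent :=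
  ⟨ctxSubst ρ S.ante, ctxSubst ρ S.succ⟩

theorem Sequent.subst_congr {S : Sequent} {ρ ρ' : Param → Tm 0}
    (h : ∀ p ∈ S.params, ρ p = ρ' p) : S.subst ρ = S.subst ρ' := by
  rw [Sequent.subst, Sequent.subst, ctxSubst_congr fun p hp => h p (.inl hp),
    ctxSubst_congr fun p hp => h p (.inr hp)]

theorem Sequent.subst_id (S : Sequent) : S.subst Tm.param = S := by
  simp [Sequent.subst, ctxSubst_id]

theorem Sequent.mem_params_subst {S : Sequent} {ρ : Param → Tm 0} {p : Param}
    (h : p ∈ (S.subst ρ).params) : ∃ q ∈ S.params, p ∈ (ρ q).params := by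
  rcases h with h | h
  · obtain ⟨q, hq, hp⟩ := mem_ctxParams_subst h
    exact ⟨q, .inl hq, hp⟩
  · obtain ⟨q, hq, hp⟩ := mem_ctxParams_subst h
    exact ⟨q, .inr hq, hp⟩

open Classical in
theorem ctxSubst_update {ρ : Param → Tm 0} {p : Param} {Γ : Multiset (Fml 0)}
    (h : p ∉ ctxParams Γ) (t : Tm 0) : ctxSubst (update ρ p t) Γ = ctxSubst ρ Γ :=
  ctxSubst_congr fun _ hq => update_of_ne (ne_of_mem_of_not_mem hq h) _ _

open Classical in
theorem Fml.subst₁_update {ρ : Param → Tm 0} {p : Param} {F : Fml 1}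
    (h : p ∉ F.params) (t : Tm 0) : F.subst₁ (update ρ p t) = F.subst₁ ρ :=
  Fml.bind_congr _ fun _ hq => by rw [update_of_ne (ne_of_mem_of_not_mem hq h)]

/-! ### Substitution in inferences and initial sequents. -/

open Classical in
/-- Inferences of **LK** are closed under substitution for the parameters, provided that fresh
eigenvariables are available. -/
theorem LKStep.subst {E E' : Param → Prop} {I I' : Tm 0 → Prop} {K : (Param → Tm 0) → Prop}
    (hfresh : ∀ s : Set Param, s.Finite → ∃ q ∉ s, E' q ∧
      ∀ ρ, K ρ → ∀ p, K (update ρ p (.param q)))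
    (hI : ∀ ρ, K ρ → ∀ t, I t → I' (t.bind ρ Tm.bvar))
    {Ps : List Sequent} {S : Sequent} (h : LKStep E I Ps S) {ρ : Param → Tm 0} (hρ : K ρ) :
    ∃ ρ', K ρ' ∧ LKStep E' I' (Ps.map fun P => P.subst ρ') (S.subst ρ) := by
  -- Only the strong quantifier rules change the substitution on the premise. `K` is an invariant of
  -- substitutions that survives redirecting an eigenvariable.
  cases h with
  | weakL => exact ⟨ρ, hρ, by
      simpa only [List.map, Sequent.subst, ctxSubst_cons] using .weakL _ _ _⟩
  | weakR => exact ⟨ρ, hρ, by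
      simpa only [List.map, Sequent.subst, ctxSubst_cons] using .weakR _ _ _⟩
  | contrL => exact ⟨ρ, hρ, by
      simpa only [List.map, Sequent.subst, ctxSubst_cons] using .contrL _ _ _⟩
  | contrR => exact ⟨ρ, hρ, by
      simpa only [List.map, Sequent.subst, ctxSubst_cons] using .contrR _ _ _⟩
  | cut A => exact ⟨ρ, hρ, by
      simpa only [List.map, Sequent.subst, ctxSubst_cons, ctxSubst_add] using
        .cut (A.subst ρ) _ _ _ _⟩
  | negL => exact ⟨ρ, hρ, by
      simpa only [List.map, Sequent.subst, ctxSubst_cons] using .negL _ _ _⟩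
  | negR => exact ⟨ρ, hρ, by
      simpa only [List.map, Sequent.subst, ctxSubst_cons] using .negR _ _ _⟩
  | andL₁ => exact ⟨ρ, hρ, by
      simpa only [List.map, Sequent.subst, ctxSubst_cons] using .andL₁ _ _ _ _⟩
  | andL₂ => exact ⟨ρ, hρ, by
      simpa only [List.map, Sequent.subst, ctxSubst_cons] using .andL₂ _ _ _ _⟩
  | andR => exact ⟨ρ, hρ, by
      simpa only [List.map, Sequent.subst, ctxSubst_cons] using .andR _ _ _ _⟩
  | orL => exact ⟨ρ, hρ, by
      simpa only [List.map, Sequent.subst, ctxSubst_cons] using .orL _ _ _ _⟩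
  | orR₁ => exact ⟨ρ, hρ, by
      simpa only [List.map, Sequent.subst, ctxSubst_cons] using .orR₁ _ _ _ _⟩
  | orR₂ => exact ⟨ρ, hρ, by
      simpa only [List.map, Sequent.subst, ctxSubst_cons] using .orR₂ _ _ _ _⟩
  | impL => exact ⟨ρ, hρ, by
      simpa only [List.map, Sequent.subst, ctxSubst_cons, ctxSubst_add] using
        .impL _ _ _ _ _ _⟩
  | impR => exact ⟨ρ, hρ, by
      simpa only [List.map, Sequent.subst, ctxSubst_cons] using .impR _ _ _ _⟩
  | allL F t Γ Δ ht => exact ⟨ρ, hρ, by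
      simpa only [List.map, Sequent.subst, ctxSubst_cons, Fml.subst_all, Fml.inst_subst] using
        .allL _ _ _ _ (hI ρ hρ t ht)⟩
  | exR F t Γ Δ ht => exact ⟨ρ, hρ, by
      simpa only [List.map, Sequent.subst, ctxSubst_cons, Fml.subst_ex, Fml.inst_subst] using
        .exR _ _ _ _ (hI ρ hρ t ht)⟩
  | allR F p Γ Δ hp hF hΓ hΔ =>
    -- The old eigenvariable may reappear in the values of `ρ`, so it is sent to a parameter that is
    -- fresh for the substituted conclusion.
    obtain ⟨q, hq, hE, hK⟩ := hfresh _ ((F.subst₁ ρ).finite_params.union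
      ((finite_ctxParams (ctxSubst ρ Γ)).union (finite_ctxParams (ctxSubst ρ Δ))))
    simp only [Set.mem_union, not_or] at hq
    refine ⟨_, hK ρ hρ p, ?_⟩
    simpa only [List.map, Sequent.subst, ctxSubst_cons, Fml.subst_all, Fml.inst_subst, Tm.bind,
      update_self, ctxSubst_update hΓ, ctxSubst_update hΔ, Fml.subst₁_update hF] using
      .allR _ q _ _ hE hq.1 hq.2.1 hq.2.2
  | exL F p Γ Δ hp hF hΓ hΔ =>
    obtain ⟨q, hq, hE, hK⟩ := hfresh _ ((F.subst₁ ρ).finite_params.union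
      ((finite_ctxParams (ctxSubst ρ Γ)).union (finite_ctxParams (ctxSubst ρ Δ))))
    simp only [Set.mem_union, not_or] at hq
    refine ⟨_, hK ρ hρ p, ?_⟩
    simpa only [List.map, Sequent.subst, ctxSubst_cons, Fml.subst_ex, Fml.inst_subst, Tm.bind,
      update_self, ctxSubst_update hΓ, ctxSubst_update hΔ, Fml.subst₁_update hF] using
      .exL _ q _ _ hE hq.1 hq.2.1 hq.2.2

theorem LKStep.mono {E E' : Param → Prop} {I I' : Tm 0 → Prop} (hE : ∀ p, E p → E' p)
    (hI : ∀ t, I t → I' t) {Ps : List Sequent} {S : Sequent} (h : LKStep E I Ps S) :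
    LKStep E' I' Ps S := by
  cases h <;> constructor <;> first | assumption | exact hE _ ‹_› | exact hI _ ‹_›

theorem PAInit.subst {S : Sequent} (h : PAInit S) (ρ : Param → Tm 0) : PAInit (S.subst ρ) := by
  cases h with
  | succ_inj => exact .succ_inj _ _
  | succ_ne_zero => exact .succ_ne_zero _
  | eq_trans => exact .eq_trans _ _ _
  | eq_succ => exact .eq_succ _ _
  | add_zero => exact .add_zero _
  | add_succ => exact .add_succ _ _
  | mul_zero => exact .mul_zero _
  | mul_succ => exact .mul_succ _ _

/-! ### Structural rules, common to both calculi. -/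

/-- A set of sequents in the parameters `V` that contains the logical initial sequents and is
closed under the inferences of **LK** whose conclusion has parameters in `V`. -/
structure LKClosed (V : Set Param) (E : Param → Prop) (I : Tm 0 → Prop)
    (D : Sequent → Prop) : Prop where
  params : ∀ {S}, D S → S.params ⊆ V
  logical : ∀ A : Fml 0, A.params ⊆ V → D ⟨{A}, {A}⟩
  step : ∀ {Ps S}, S.params ⊆ V → LKStep E I Ps S → (∀ P ∈ Ps, D P) → D S

namespace LKClosed

variable {V : Set Param} {E : Param → Prop} {I : Tm 0 → Prop} {D : Sequent → Prop}
  {A B : Fml 0} {Γ Γ' Δ Δ' Θ : Multiset (Fml 0)}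

theorem ante_params (hD : LKClosed V E I D) (h : D ⟨Γ, Δ⟩) : ctxParams Γ ⊆ V :=
  Set.subset_union_left.trans (hD.params h)

theorem succ_params (hD : LKClosed V E I D) (h : D ⟨Γ, Δ⟩) : ctxParams Δ ⊆ V :=
  Set.subset_union_right.trans (hD.params h)

theorem head_ante_params (hD : LKClosed V E I D) (h : D ⟨A ::ₘ Γ, Δ⟩) : A.params ⊆ V := by
  have := hD.ante_params h
  rw [ctxParams_cons] at this
  exact Set.subset_union_left.trans this

theorem head_succ_params (hD : LKClosed V E I D) (h : D ⟨Γ, A ::ₘ Δ⟩) : A.params ⊆ V := by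
  have := hD.succ_params h
  rw [ctxParams_cons] at this
  exact Set.subset_union_left.trans this

theorem tail_ante_params (hD : LKClosed V E I D) (h : D ⟨A ::ₘ Γ, Δ⟩) : ctxParams Γ ⊆ V := by
  have := hD.ante_params h
  rw [ctxParams_cons] at this
  exact Set.subset_union_right.trans this

theorem tail_succ_params (hD : LKClosed V E I D) (h : D ⟨Γ, A ::ₘ Δ⟩) : ctxParams Δ ⊆ V := by
  have := hD.succ_params h
  rw [ctxParams_cons] at this
  exact Set.subset_union_right.trans this

theorem cons_params (hA : A.params ⊆ V) (hΓ : ctxParams Γ ⊆ V) : ctxParams (A ::ₘ Γ) ⊆ V := by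
  rw [ctxParams_cons]
  exact Set.union_subset hA hΓ

theorem step₁ (hD : LKClosed V E I D) {P : Sequent} (h : LKStep E I [P] ⟨Γ, Δ⟩)
    (hΓ : ctxParams Γ ⊆ V) (hΔ : ctxParams Δ ⊆ V) (d : D P) : D ⟨Γ, Δ⟩ :=
  hD.step (Set.union_subset hΓ hΔ) h (by simpa using d)

theorem step₂ (hD : LKClosed V E I D) {P Q : Sequent} (h : LKStep E I [P, Q] ⟨Γ, Δ⟩)
    (hΓ : ctxParams Γ ⊆ V) (hΔ : ctxParams Δ ⊆ V) (d : D P) (d' : D Q) : D ⟨Γ, Δ⟩ :=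
  hD.step (Set.union_subset hΓ hΔ) h (by simpa using ⟨d, d'⟩)

theorem weakL (hD : LKClosed V E I D) (hA : A.params ⊆ V) (d : D ⟨Γ, Δ⟩) : D ⟨A ::ₘ Γ, Δ⟩ :=
  hD.step₁ (.weakL _ _ _) (cons_params hA (hD.ante_params d)) (hD.succ_params d) d

theorem weakL_add (hD : LKClosed V E I D) (hΘ : ctxParams Θ ⊆ V) (d : D ⟨Γ, Δ⟩) :
    D ⟨Θ + Γ, Δ⟩ := by
  induction Θ using Multiset.induction_on with
  | empty => simpa using d
  | cons A Θ ih =>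
    rw [ctxParams_cons, Set.union_subset_iff] at hΘ
    rw [Multiset.cons_add]
    exact hD.weakL hΘ.1 (ih hΘ.2)

theorem weakR_add (hD : LKClosed V E I D) (hΘ : ctxParams Θ ⊆ V) (d : D ⟨Γ, Δ⟩) :
    D ⟨Γ, Θ + Δ⟩ := by
  induction Θ using Multiset.induction_on with
  | empty => simpa using d
  | cons A Θ ih =>
    rw [ctxParams_cons, Set.union_subset_iff] at hΘ
    rw [Multiset.cons_add]
    have := ih hΘ.2
    exact hD.step₁ (.weakR _ _ _) (hD.ante_params d) (cons_params hΘ.1 (hD.succ_params this)) this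

theorem contrL_add (hD : LKClosed V E I D) (h : Γ ⊆ Γ') (d : D ⟨Γ + Γ', Δ⟩) : D ⟨Γ', Δ⟩ := by
  induction Γ using Multiset.induction_on with
  | empty => simpa using d
  | cons A Γ ih =>
    rw [Multiset.cons_subset] at h
    obtain ⟨Γ'', rfl⟩ := Multiset.exists_cons_of_mem h.1
    rw [Multiset.cons_add, Multiset.add_cons] at d
    refine ih h.2 ?_
    rw [Multiset.add_cons]
    exact hD.step₁ (.contrL _ _ _) (hD.tail_ante_params d) (hD.succ_params d) d

theorem contrR_add (hD : LKClosed V E I D) (h : Δ ⊆ Δ') (d : D ⟨Γ, Δ + Δ'⟩) : D ⟨Γ, Δ'⟩ := by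
  induction Δ using Multiset.induction_on with
  | empty => simpa using d
  | cons A Δ ih =>
    rw [Multiset.cons_subset] at h
    obtain ⟨Γ'', rfl⟩ := Multiset.exists_cons_of_mem h.1
    rw [Multiset.cons_add, Multiset.add_cons] at d
    refine ih h.2 ?_
    rw [Multiset.add_cons]
    exact hD.step₁ (.contrR _ _ _) (hD.ante_params d) (hD.tail_succ_params d) d

/-- Weakening and contraction combined. -/
theorem mono (hD : LKClosed V E I D) (hΓ : Γ ⊆ Γ') (hΔ : Δ ⊆ Δ') (hΓ' : ctxParams Γ' ⊆ V)
    (hΔ' : ctxParams Δ' ⊆ V) (d : D ⟨Γ, Δ⟩) : D ⟨Γ', Δ'⟩ := by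
  -- Inclusion of multisets ignores multiplicities: the larger context is added by weakening and the
  -- smaller one is contracted into it.
  refine hD.contrL_add hΓ (hD.contrR_add hΔ ?_)
  rw [add_comm Γ, add_comm Δ]
  exact hD.weakL_add hΓ' (hD.weakR_add hΔ' d)

/-- The context-sharing form of cut. The primitive rule duplicates the context, which is then
contracted. -/
theorem cut (hD : LKClosed V E I D) (d : D ⟨Γ, A ::ₘ Δ⟩) (d' : D ⟨A ::ₘ Γ, Δ⟩) : D ⟨Γ, Δ⟩ := by
  have hΓ := hD.ante_params d
  have hΔ := hD.succ_params d'
  refine hD.mono (Γ := Γ + Γ) (Δ := Δ + Δ) (fun _ h => by simpa using h)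
    (fun _ h => by simpa using h) hΓ hΔ
    (hD.step₂ (.cut A _ _ _ _) ?_ ?_ d d') <;> simp [ctxParams_add, *]

theorem cut_ante (hD : LKClosed V E I D) (h : ∀ A ∈ Θ, D ⟨Γ, A ::ₘ Δ⟩) (d : D ⟨Θ + Γ, Δ⟩) :
    D ⟨Γ, Δ⟩ := by
  induction Θ using Multiset.induction_on with
  | empty => simpa using d
  | cons A Θ ih =>
    rw [Multiset.cons_add] at d
    refine ih (fun B hB => h B (Multiset.mem_cons_of_mem hB)) (hD.cut (A := A) ?_ d)
    have hA := h A (Multiset.mem_cons_self A Θ)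
    exact hD.mono (fun _ h => by simp [h]) (Multiset.Subset.refl _) (hD.tail_ante_params d)
      (hD.succ_params hA) hA

theorem cut_succ (hD : LKClosed V E I D) (h : ∀ A ∈ Θ, D ⟨A ::ₘ Γ, Δ⟩) (d : D ⟨Γ, Θ + Δ⟩) :
    D ⟨Γ, Δ⟩ := by
  induction Θ using Multiset.induction_on with
  | empty => simpa using d
  | cons A Θ ih =>
    rw [Multiset.cons_add] at d
    refine ih (fun B hB => h B (Multiset.mem_cons_of_mem hB)) (hD.cut (A := A) d ?_)
    have hA := h A (Multiset.mem_cons_self A Θ)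
    exact hD.mono (Multiset.Subset.refl _) (fun _ h => by simp [h]) (hD.ante_params hA)
      (hD.tail_succ_params d) hA

/-- A derivable sequent is applied to derivable premises. -/
theorem apply (hD : LKClosed V E I D) (d : D ⟨Θ, {B}⟩) (hΓ : ctxParams Γ ⊆ V)
    (h : ∀ A ∈ Θ, D ⟨Γ, {A}⟩) : D ⟨Γ, {B}⟩ := by
  have hB := hD.succ_params d
  refine hD.cut_ante (Θ := Θ) (fun A hA => ?_) ?_
  · have := h A hA
    refine hD.mono (Multiset.Subset.refl _) (by simp) hΓ (cons_params ?_ hB) this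
    simpa [ctxParams_singleton] using hD.succ_params this
  · rw [add_comm]
    exact hD.weakL_add hΓ d

theorem assumption (hD : LKClosed V E I D) (hA : A ∈ Γ) (hΓ : ctxParams Γ ⊆ V) :
    D ⟨Γ, {A}⟩ := by
  have h : A.params ⊆ V := fun p hp => hΓ ⟨A, hA, hp⟩
  exact hD.mono (by simpa using hA) (Multiset.Subset.refl _) hΓ
    (by rwa [ctxParams_singleton]) (hD.logical A h)

end LKClosed

/-! ### The **PA**-calculus: substitution, equational reasoning, and simulation of *mv***LKIE**. -/

/-- Provability in the **PA**-calculus. -/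
def PA (S : Sequent) : Prop := Nonempty (PAProof S)

namespace PA

theorem closed : LKClosed Set.univ (fun _ => True) (fun _ => True) PA where
  params _ := Set.subset_univ _
  logical A _ := ⟨.logical A⟩
  step _ h d := ⟨.lk h fun P hP => (d P hP).some⟩

open Classical in
theorem subst {S : Sequent} (d : PAProof S) (ρ : Param → Tm 0) : PA (S.subst ρ) := by
  induction d generalizing ρ with
  | logical A => exact ⟨.logical _⟩
  | init h => exact ⟨.init (h.subst ρ)⟩
  | lk h d ih =>
    obtain ⟨ρ', -, h'⟩ := h.subst (E' := fun _ => True) (I' := fun _ => True)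
      (K := fun _ => True)
      (fun s hs => (exists_fresh_passive hs).elim fun i hi => ⟨_, hi, trivial, fun _ _ _ => trivial⟩)
      (fun _ _ _ _ => trivial) (ρ := ρ) trivial
    refine closed.step (Set.subset_univ _) h' fun P hP => ?_
    obtain ⟨Q, hQ, rfl⟩ := List.mem_map.1 hP
    exact ih Q hQ ρ'
  | ind F a t Γ Δ hF hΓ hΔ d ih =>
    -- The induction variable is renamed before `ρ` is applied, since the values of `ρ` may contain
    -- it.
    obtain ⟨i, hi⟩ := exists_fresh_passive ((F.subst₁ ρ).finite_params.union
      ((finite_ctxParams (ctxSubst ρ Γ)).union (finite_ctxParams (ctxSubst ρ Δ))))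
    simp only [Set.mem_union, not_or] at hi
    have := ih (update ρ a (.param (.passive i)))
    simp only [Sequent.subst, ctxSubst_cons, Fml.inst_subst, Tm.bind,
      update_self, ctxSubst_update hΓ, ctxSubst_update hΔ, Fml.subst₁_update hF] at this ⊢
    exact ⟨.ind _ _ _ _ _ hi.1 hi.2.1 hi.2.2 this.some⟩

variable {Γ : Multiset (Fml 0)} {r s t s₁ s₂ t₁ t₂ : Tm 0}

theorem of_init {Θ : Multiset (Fml 0)} {B : Fml 0} (h : PAInit ⟨Θ, {B}⟩)
    (hΘ : ∀ A ∈ Θ, PA ⟨Γ, {A}⟩) : PA ⟨Γ, {B}⟩ :=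
  closed.apply ⟨.init h⟩ (Set.subset_univ _) hΘ

theorem assumption {A : Fml 0} (h : A ∈ Γ) : PA ⟨Γ, {A}⟩ :=
  closed.assumption h (Set.subset_univ _)

theorem eq_trans' (h : PA ⟨Γ, {.eq s t}⟩) (h' : PA ⟨Γ, {.eq s r}⟩) : PA ⟨Γ, {.eq t r}⟩ :=
  of_init (.eq_trans s t r) (by simpa using ⟨h, h'⟩)

theorem add_zero (s : Tm 0) : PA ⟨Γ, {.eq (.add s .zero) s}⟩ := of_init (.add_zero s) (by simp)

theorem add_succ (s t : Tm 0) : PA ⟨Γ, {.eq (.add s t.succ) (Tm.add s t).succ}⟩ :=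
  of_init (.add_succ s t) (by simp)

theorem mul_zero (s : Tm 0) : PA ⟨Γ, {.eq (.mul s .zero) .zero}⟩ :=
  of_init (.mul_zero s) (by simp)

theorem mul_succ (s t : Tm 0) : PA ⟨Γ, {.eq (.mul s t.succ) (.add (.mul s t) s)}⟩ :=
  of_init (.mul_succ s t) (by simp)

/-- Two copies of `s + 0 = s` and the Euclidean form of transitivity give reflexivity. -/
theorem refl (s : Tm 0) : PA ⟨Γ, {.eq s s}⟩ := eq_trans' (add_zero s) (add_zero s)

theorem symm (h : PA ⟨Γ, {.eq s t}⟩) : PA ⟨Γ, {.eq t s}⟩ := eq_trans' h (refl s)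

theorem trans (h : PA ⟨Γ, {.eq s t}⟩) (h' : PA ⟨Γ, {.eq t r}⟩) : PA ⟨Γ, {.eq s r}⟩ :=
  eq_trans' (symm h) h'

theorem succ (h : PA ⟨Γ, {.eq s t}⟩) : PA ⟨Γ, {.eq s.succ t.succ}⟩ :=
  of_init (.eq_succ s t) (by simpa using h)

/-- Equations between terms are provable by induction. -/
theorem ind_eq (f g : Tm 1) (t : Tm 0)
    (h₀ : PA ⟨Γ, {(Fml.eq f g).inst .zero}⟩)
    (hs : ∀ a, PA ⟨(Fml.eq f g).inst (.param a) ::ₘ Γ,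
      {(Fml.eq f g).inst (Tm.succ (.param a))}⟩) :
    PA ⟨Γ, {(Fml.eq f g).inst t}⟩ := by
  obtain ⟨i, hi⟩ := exists_fresh_passive ((Fml.eq f g).finite_params.union (finite_ctxParams Γ))
  simp only [Set.mem_union, not_or] at hi
  have h : PA ⟨(Fml.eq f g).inst .zero ::ₘ Γ, {(Fml.eq f g).inst t}⟩ :=
    ⟨.ind _ (.passive i) _ _ _ hi.1 hi.2 (by simp [ctxParams_zero]) (hs _).some⟩
  refine closed.apply h (Set.subset_univ _) fun A hA => ?_
  rcases Multiset.mem_cons.1 hA with rfl | hA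
  exacts [h₀, assumption hA]

theorem bind_lift_id (s u : Tm 0) : s.lift.bind Tm.param (fun _ => u) = s := by
  rw [Tm.lift_bind, Subsingleton.elim (fun i : Fin 0 => u) Tm.bvar, Tm.bind_id]

/-- Recursion is on the second argument, so congruence in the first is a direct induction.
Congruence in the second is reduced to it by commutativity; multiplication is treated in the same
way. -/
theorem add_left (t : Tm 0) (h : PA ⟨Γ, {.eq s₁ s₂}⟩) :
    PA ⟨Γ, {.eq (.add s₁ t) (.add s₂ t)}⟩ := by
  have := ind_eq (Γ := Γ) (.add s₁.lift (.bvar 0)) (.add s₂.lift (.bvar 0)) t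
  simp only [Fml.inst, Fml.bind, Tm.bind, bind_lift_id] at this
  refine this (trans (add_zero _) (trans h (symm (add_zero _)))) fun a => ?_
  exact trans (add_succ _ _) (trans (succ (assumption (by simp))) (symm (add_succ _ _)))

theorem zero_add (t : Tm 0) : PA ⟨Γ, {.eq (.add .zero t) t}⟩ := by
  have := ind_eq (Γ := Γ) (.add .zero (.bvar 0)) (.bvar 0) t
  simp only [Fml.inst, Fml.bind, Tm.bind] at this
  refine this (add_zero _) fun a => ?_
  exact trans (add_succ _ _) (succ (assumption (by simp)))

theorem succ_add (s t : Tm 0) : PA ⟨Γ, {.eq (.add s.succ t) (Tm.add s t).succ}⟩ := by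
  have := ind_eq (Γ := Γ) (.add s.lift.succ (.bvar 0)) (Tm.add s.lift (.bvar 0)).succ t
  simp only [Fml.inst, Fml.bind, Tm.bind, bind_lift_id] at this
  refine this (trans (add_zero _) (symm (succ (add_zero _)))) fun a => ?_
  exact trans (add_succ _ _) (trans (succ (assumption (by simp))) (symm (succ (add_succ _ _))))

theorem add_comm (s t : Tm 0) : PA ⟨Γ, {.eq (.add s t) (.add t s)}⟩ := by
  have := ind_eq (Γ := Γ) (.add s.lift (.bvar 0)) (.add (.bvar 0) s.lift) t
  simp only [Fml.inst, Fml.bind, Tm.bind, bind_lift_id] at this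
  refine this (trans (add_zero _) (symm (zero_add _))) fun a => ?_
  exact trans (add_succ _ _) (trans (succ (assumption (by simp))) (symm (succ_add _ _)))

theorem add (h : PA ⟨Γ, {.eq s₁ t₁}⟩) (h' : PA ⟨Γ, {.eq s₂ t₂}⟩) :
    PA ⟨Γ, {.eq (.add s₁ s₂) (.add t₁ t₂)}⟩ :=
  trans (add_left _ h) (trans (add_comm _ _) (trans (add_left _ h') (add_comm _ _)))

theorem add_assoc (r s t : Tm 0) :
    PA ⟨Γ, {.eq (.add (.add r s) t) (.add r (.add s t))}⟩ := by
  have := ind_eq (Γ := Γ) (.add (.add r.lift s.lift) (.bvar 0))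
    (.add r.lift (.add s.lift (.bvar 0))) t
  simp only [Fml.inst, Fml.bind, Tm.bind, bind_lift_id] at this
  refine this (trans (add_zero _) (symm (add (refl _) (add_zero _)))) fun a => ?_
  exact trans (add_succ _ _) (trans (succ (assumption (by simp)))
    (symm (trans (add (refl _) (add_succ _ _)) (add_succ _ _))))

theorem mul_left (t : Tm 0) (h : PA ⟨Γ, {.eq s₁ s₂}⟩) :
    PA ⟨Γ, {.eq (.mul s₁ t) (.mul s₂ t)}⟩ := by
  have := ind_eq (Γ := Γ) (.mul s₁.lift (.bvar 0)) (.mul s₂.lift (.bvar 0)) t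
  simp only [Fml.inst, Fml.bind, Tm.bind, bind_lift_id] at this
  refine this (trans (mul_zero _) (symm (mul_zero _))) fun a => ?_
  have h' := closed.weakL_add (Θ := {.eq (.mul s₁ (.param a)) (.mul s₂ (.param a))})
    (Set.subset_univ _) h
  exact trans (mul_succ _ _) (trans (add (assumption (by simp)) h') (symm (mul_succ _ _)))

theorem zero_mul (t : Tm 0) : PA ⟨Γ, {.eq (.mul .zero t) .zero}⟩ := by
  have := ind_eq (Γ := Γ) (.mul .zero (.bvar 0)) .zero t
  simp only [Fml.inst, Fml.bind, Tm.bind] at this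
  refine this (mul_zero _) fun a => ?_
  exact trans (mul_succ _ _) (trans (add_zero _) (assumption (by simp)))

theorem succ_mul (s t : Tm 0) : PA ⟨Γ, {.eq (.mul s.succ t) (.add (.mul s t) t)}⟩ := by
  have := ind_eq (Γ := Γ) (.mul s.lift.succ (.bvar 0))
    (.add (.mul s.lift (.bvar 0)) (.bvar 0)) t
  simp only [Fml.inst, Fml.bind, Tm.bind, bind_lift_id] at this
  refine this (trans (mul_zero _) (symm (trans (add_zero _) (mul_zero _)))) fun a => ?_
  -- Both sides are successors; it remains to show `s·a' + a = s'·a + s`, which follows by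
  -- regrouping `s·a + s + a` and the induction hypothesis.
  refine trans (mul_succ _ _) (trans (add_succ _ _) (symm (trans (add_succ _ _) (succ ?_))))
  refine trans (add (mul_succ _ _) (refl _)) (trans (add_assoc _ _ _) ?_)
  refine trans (add (refl _) (add_comm _ _)) (trans (symm (add_assoc _ _ _)) ?_)
  exact add (symm (assumption (by simp))) (refl _)

theorem mul_comm (s t : Tm 0) : PA ⟨Γ, {.eq (.mul s t) (.mul t s)}⟩ := by
  have := ind_eq (Γ := Γ) (.mul s.lift (.bvar 0)) (.mul (.bvar 0) s.lift) t
  simp only [Fml.inst, Fml.bind, Tm.bind, bind_lift_id] at this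
  refine this (trans (mul_zero _) (symm (zero_mul _))) fun a => ?_
  exact trans (mul_succ _ _) (trans (add (assumption (by simp)) (refl _)) (symm (succ_mul _ _)))

theorem mul (h : PA ⟨Γ, {.eq s₁ t₁}⟩) (h' : PA ⟨Γ, {.eq s₂ t₂}⟩) :
    PA ⟨Γ, {.eq (.mul s₁ s₂) (.mul t₁ t₂)}⟩ :=
  trans (mul_left _ h) (trans (mul_comm _ _) (trans (mul_left _ h') (mul_comm _ _)))

theorem of_eqInit {S : Sequent} (h : EqInit S) : PA S := by
  cases h with
  | refl s => exact refl s
  | succ => exact succ (assumption (by simp))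
  | add => exact add (assumption (by simp)) (assumption (by simp))
  | mul => exact mul (assumption (by simp)) (assumption (by simp))
  | eq s₁ s₂ t₁ t₂ =>
    exact trans (symm (s := s₁) (assumption (by simp)))
      (trans (t := s₂) (assumption (by simp)) (assumption (by simp)))

-- Internal parameters instantiated by `σ` behave like implicitly universally quantified variables
-- of the premise: they are fixed where they occur in the side formulas, so substitution leaves
-- these formulas unchanged.
open Classical in
theorem mvInd {F : Fml 1} {n : ℕ} {σ : ℕ → Tm 0} {Γ Δ : Multiset (Fml 0)} (t : Tm 0)
    (hF : Param.active n ∉ F.params)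
    (hΓ : Param.active n ∉ ctxParams Γ) (hΔ : Param.active n ∉ ctxParams Δ)
    (hσ : ∀ i : ℕ, Param.internal i ∈ ctxParams Γ ∪ ctxParams Δ → σ i = .param (.internal i))
    (d : PA ⟨F.inst (.param (.active n)) ::ₘ Γ, F.inst (Tm.succ (.param (.active n))) ::ₘ Δ⟩) :
    PA ⟨F.bind (internalInst σ) (fun _ => .zero) ::ₘ Γ,
      F.bind (internalInst σ) (fun _ => t) ::ₘ Δ⟩ := by
  have h : ∀ p ∈ ctxParams Γ ∪ ctxParams Δ, internalInst σ p = .param p := by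
    rintro (i | i | i) hp
    exacts [rfl, rfl, hσ i hp]
  obtain ⟨i, hi⟩ := exists_fresh_passive ((F.subst₁ (internalInst σ)).finite_params.union
    ((finite_ctxParams Γ).union (finite_ctxParams Δ)))
  simp only [Set.mem_union, not_or] at hi
  -- One substitution instantiates the internal parameters and makes the induction variable fresh,
  -- as the terms `σ i` may contain the active parameter.
  have := subst d.some (update (internalInst σ) (.active n) (.param (.passive i)))
  simp only [Sequent.subst, ctxSubst_cons, Fml.inst_subst, Tm.bind,
    update_self, ctxSubst_update hΓ, ctxSubst_update hΔ, Fml.subst₁_update hF,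
    ctxSubst_congr fun p hp => h p (.inl hp), ctxSubst_congr fun p hp => h p (.inr hp),
    ctxSubst_id] at this
  rw [← Fml.inst_subst₁, ← Fml.inst_subst₁]
  exact ⟨.ind _ _ _ _ _ hi.1 hi.2.1 hi.2.2 this.some⟩

theorem of_mvLKIE {S : Sequent} (d : MvLKIE S) (hd : d.EFree) : PA S := by
  induction d with
  | logical A => exact ⟨.logical A⟩
  | init _ h => exact h.elim (fun h => ⟨.init h⟩) of_eqInit
  | lk hS h d ih =>
    exact closed.step (Set.subset_univ _) (h.mono (fun _ _ => trivial) fun _ _ => trivial)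
      fun P hP => ih P hP (hd P hP)
  | mvInd F n σ t Γ Δ hS hF hΓ hΔ hσ d ih => exact mvInd t hF hΓ hΔ hσ (ih hd)
  | eqE => exact hd.elim

end PA

/-! ### Sequents with one designated active parameter. -/

/-- The parameters other than active parameters different from the `n`-th one. -/
def soleActive (n : ℕ) : Set Param := {p | ∀ i, p = .active i → i = n}

theorem passive_mem_soleActive (n i : ℕ) : Param.passive i ∈ soleActive n := fun _ h => nomatch h

theorem active_mem_soleActive (n : ℕ) : Param.active n ∈ soleActive n :=
  fun _ h => (Param.active.inj h).symm

theorem Sequent.isSchematic_of_subset {S : Sequent} {n : ℕ} (h : S.params ⊆ soleActive n) :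
    S.IsSchematic :=
  fun i j hi hj => (h hi i rfl).trans (h hj j rfl).symm

theorem Sequent.IsSchematic.exists_subset {S : Sequent} (h : S.IsSchematic) :
    ∃ n, S.params ⊆ soleActive n := by
  by_cases hn : ∃ n, Param.active n ∈ S.params
  · obtain ⟨n, hn⟩ := hn
    exact ⟨n, fun _ hp i hi => h i n (hi ▸ hp) hn⟩
  -- Without active parameters any index will do.
  · exact ⟨0, fun _ hp i hi => (hn ⟨i, hi ▸ hp⟩).elim⟩

theorem Tm.IsPassive.params_subset {t : Tm 0} (h : t.IsPassive) (n : ℕ) :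
    t.params ⊆ soleActive n := by
  intro p hp
  obtain ⟨i, rfl⟩ := h p hp
  exact passive_mem_soleActive n i

theorem Tm.isPassive_param (i : ℕ) : (Tm.param (.passive i)).IsPassive := fun _ hp => ⟨i, hp⟩

theorem Fml.params_bind_subset {k m : ℕ} {V : Set Param} {A : Fml k} {ρ : Param → Tm m}
    {σ : Fin k → Tm m} (hρ : ∀ p ∈ A.params, (ρ p).params ⊆ V) (hσ : ∀ i, (σ i).params ⊆ V) :
    (A.bind ρ σ).params ⊆ V := fun _ hp =>
  (mem_params_bind hp).elim (fun ⟨q, hq, h⟩ => hρ q hq h) fun ⟨i, h⟩ => hσ i h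

theorem Sequent.params_subst_subset {V : Set Param} {S : Sequent} {ρ : Param → Tm 0}
    (hρ : ∀ p, (ρ p).params ⊆ V) : (S.subst ρ).params ⊆ V := fun _ hp =>
  (mem_params_subst hp).elim fun q h => hρ q h.2

/-- Opening a binder after a substitution amounts to one more value in the substitution. This lets
Leibniz's law pass under quantifiers while all substituted terms stay closed. -/
theorem Fml.inst_bind {k : ℕ} (A : Fml (k + 1)) (ρ : Param → Tm 0) (σ : Fin k → Tm 0) (t : Tm 0) :
    Fml.inst (A.bind (fun p => (ρ p).lift) (Fin.cases (.bvar 0) fun i => (σ i).lift)) t =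
      A.bind ρ (Fin.cases t σ) := by
  rw [inst, bind_bind]
  simp only [PA.bind_lift_id]
  congr 1
  funext i
  cases i using Fin.cases <;> simp [Tm.bind, PA.bind_lift_id]

/-! ### Derived rules of *mv***LKIE**: induction, values of terms, Leibniz's law. -/

/-- Derivability without the rule of the equational theory, of sequents in which at most the
`n`-th active parameter occurs. -/
def Mv (n : ℕ) (S : Sequent) : Prop := (∃ d : MvLKIE S, d.EFree) ∧ S.params ⊆ soleActive n

namespace Mv

variable {n : ℕ}

theorem closed : LKClosed (soleActive n) (fun p => ∃ i, p = .passive i) Tm.IsPassive (Mv n) where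
  params h := h.2
  logical A hA := by
    have h : Sequent.params ⟨{A}, {A}⟩ ⊆ soleActive n := by
      simpa [Sequent.params, ctxParams_singleton] using hA
    exact ⟨⟨.logical A (Sequent.isSchematic_of_subset h), trivial⟩, h⟩
  step hS h d := by
    choose e he using fun P hP => (d P hP).1
    exact ⟨⟨.lk (Sequent.isSchematic_of_subset hS) h e, he⟩, hS⟩

theorem init {S : Sequent} (h : PAInit S ∨ EqInit S) (hS : S.params ⊆ soleActive n) : Mv n S :=
  ⟨⟨.init (Sequent.isSchematic_of_subset hS) h, trivial⟩, hS⟩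

/-- Instantiating every internal parameter by itself turns *mv***IND** into ordinary induction and
makes its side condition trivial. -/
theorem ind {F : Fml 1} {Γ Δ : Multiset (Fml 0)} {t : Tm 0} (ht : t.params ⊆ soleActive n)
    (hF : Param.active n ∉ F.params) (hΓ : Param.active n ∉ ctxParams Γ)
    (hΔ : Param.active n ∉ ctxParams Δ)
    (d : Mv n ⟨F.inst (.param (.active n)) ::ₘ Γ, F.inst (Tm.succ (.param (.active n))) ::ₘ Δ⟩) :
    Mv n ⟨F.inst .zero ::ₘ Γ, F.inst t ::ₘ Δ⟩ := by
  have hF' := (F.params_subset_inst _).trans (closed.head_ante_params d)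
  have hinst : ∀ {s : Tm 0}, s.params ⊆ soleActive n → (F.inst s).params ⊆ soleActive n :=
    fun hs _ hp => (Fml.mem_params_inst hp).elim (fun h => hF' h) fun h => hs h
  have hS : Sequent.params ⟨F.inst .zero ::ₘ Γ, F.inst t ::ₘ Δ⟩ ⊆ soleActive n :=
    Set.union_subset
      (LKClosed.cons_params (hinst (Set.empty_subset _)) (closed.tail_ante_params d))
      (LKClosed.cons_params (hinst ht) (closed.tail_succ_params d))
  have hσ : internalInst (fun i => .param (.internal i)) = Tm.param := by
    funext p
    cases p <;> rfl
  obtain ⟨⟨e, he⟩, -⟩ := d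
  have hS' := Sequent.isSchematic_of_subset hS
  rw [Fml.inst, Fml.inst, ← hσ] at hS'
  have h : ∃ d : MvLKIE _, d.EFree :=
    ⟨.mvInd F n (fun i => .param (.internal i)) t Γ Δ hS' hF hΓ hΔ (fun _ _ => rfl) e, he⟩
  rw [hσ] at h
  exact ⟨h, hS⟩

/-- Every term has a value. -/
theorem ex_eq {t : Tm 0} (ht : t.params ⊆ soleActive n) :
    Mv n ⟨0, {.ex (.eq (.bvar 0) t.lift)}⟩ := by
  have hx : ∀ {s : Tm 0}, s.params ⊆ soleActive n →
      ctxParams {.ex (.eq (.bvar 0) s.lift)} ⊆ soleActive n := fun {s} hs => by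
    simpa [ctxParams_singleton, Fml.params, Tm.params, Tm.params_lift] using hs
  have h₀ : ctxParams 0 ⊆ soleActive n := by simp [ctxParams_zero]
  have ha := Set.singleton_subset_iff.2 (active_mem_soleActive n)
  have hp := Set.singleton_subset_iff.2 (passive_mem_soleActive n 0)
  have hinst : ∀ s u : Tm 0, (Fml.eq (.bvar 0) s.lift).inst u = .eq u s := fun s u => by
    simp [Fml.inst, Fml.bind, Tm.bind, PA.bind_lift_id]
  have hs : Mv n ⟨{.ex (.eq (.bvar 0) (Tm.param (.active n)).lift)},
      {.ex (.eq (.bvar 0) (Tm.param (.active n)).succ.lift)}⟩ := by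
    refine closed.step₁ (.exL _ (.passive 0) 0 _ ⟨0, rfl⟩ ?_ ?_ ?_) (hx ha) (hx ha) ?_
    · simp [Fml.params, Tm.params, Tm.lift]
    · simp [ctxParams_zero]
    · simp [ctxParams_singleton, Fml.params, Tm.params, Tm.lift]
    -- If the passive eigenvariable is a value of `n`, its successor is a value of `n'`. This
    -- witness is passive, hence may be quantified.
    refine closed.step₁ (.exR _ (Tm.param (.passive 0)).succ _ 0 (Tm.isPassive_param 0)) ?_
      (hx ha) ?_
    · rw [hinst]
      exact LKClosed.cons_params (Set.union_subset hp ha) h₀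
    rw [hinst, hinst]
    refine init (.inl (.eq_succ _ _)) (Set.union_subset ?_ ?_) <;>
      exact LKClosed.cons_params (Set.union_subset hp ha) h₀
  -- Unlike the quantifier rules, induction may conclude with a term that is not passive. Under the
  -- quantifier, `.bvar 1` is the induction variable.
  have h := ind (F := .ex (.eq (.bvar 0) (.bvar 1))) (Γ := 0) (Δ := 0) ht
    (by simp [Fml.params, Tm.params]) (by simp [ctxParams_zero]) (by simp [ctxParams_zero]) hs
  refine closed.cut (A := .ex (.eq (.bvar 0) (Tm.lift .zero))) ?_ h
  refine closed.mono (Δ := {.ex (.eq (.bvar 0) (Tm.lift .zero))}) (Multiset.Subset.refl _)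
    (by simp) h₀ (LKClosed.cons_params ?_ (hx ht)) ?_
  · simp [Fml.params, Tm.params, Tm.lift]
  refine closed.step₁ (.exR _ Tm.zero _ 0 fun _ h => h.elim) h₀ (hx (Set.empty_subset _)) ?_
  rw [hinst]
  exact init (.inr (.refl _)) (by simp [Sequent.params, ctxParams_zero, ctxParams_singleton,
    Fml.params, Tm.params])

variable {Γ : Multiset (Fml 0)}

theorem refl (hΓ : ctxParams Γ ⊆ soleActive n) {s : Tm 0} (hs : s.params ⊆ soleActive n) :
    Mv n ⟨Γ, {.eq s s}⟩ :=
  closed.apply (init (.inr (.refl s)) (by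
    simpa [Sequent.params, ctxParams_zero, ctxParams_singleton, Fml.params] using hs)) hΓ
    (by simp)

theorem eq_params {s t : Tm 0} (h : Mv n ⟨Γ, {.eq s t}⟩) :
    s.params ⊆ soleActive n ∧ t.params ⊆ soleActive n := by
  simpa [ctxParams_singleton, Fml.params] using closed.succ_params h

theorem eq_trans' {r s t : Tm 0} (h : Mv n ⟨Γ, {.eq s t}⟩) (h' : Mv n ⟨Γ, {.eq s r}⟩) :
    Mv n ⟨Γ, {.eq t r}⟩ :=
  closed.apply (init (.inl (.eq_trans s t r)) (by
    simp [Sequent.params, ctxParams_cons, ctxParams_singleton, Fml.params, eq_params h,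
      eq_params h'])) (closed.ante_params h) (by simpa using ⟨h, h'⟩)

theorem symm {s t : Tm 0} (h : Mv n ⟨Γ, {.eq s t}⟩) : Mv n ⟨Γ, {.eq t s}⟩ :=
  eq_trans' h (refl (closed.ante_params h) (eq_params h).1)

theorem bind_eq_bind {k : ℕ} (hΓ : ctxParams Γ ⊆ soleActive n) (t : Tm k) {ρ ρ' : Param → Tm 0}
    {σ σ' : Fin k → Tm 0} (hρ : ∀ p ∈ t.params, Mv n ⟨Γ, {.eq (ρ p) (ρ' p)}⟩)
    (hσ : ∀ i, Mv n ⟨Γ, {.eq (σ i) (σ' i)}⟩) :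
    Mv n ⟨Γ, {.eq (t.bind ρ σ) (t.bind ρ' σ')}⟩ := by
  induction t with
  | param p => exact hρ p rfl
  | bvar i => exact hσ i
  | zero => exact refl hΓ (Set.empty_subset _)
  | succ t ih =>
    have h := ih hρ
    exact closed.apply (init (.inr (.succ _ _)) (by
      simp [Sequent.params, ctxParams_singleton, Fml.params, Tm.params, Tm.bind, eq_params h])) hΓ
      (by simpa using h)
  | add s t ihs iht =>
    have h := ihs fun p hp => hρ p (.inl hp)
    have h' := iht fun p hp => hρ p (.inr hp)
    exact closed.apply (init (.inr (.add _ _ _ _)) (by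
      simp [Sequent.params, ctxParams_cons, ctxParams_singleton, Fml.params, Tm.params,
        Tm.bind, eq_params h, eq_params h'])) hΓ (by simpa using ⟨h, h'⟩)
  | mul s t ihs iht =>
    have h := ihs fun p hp => hρ p (.inl hp)
    have h' := iht fun p hp => hρ p (.inr hp)
    exact closed.apply (init (.inr (.mul _ _ _ _)) (by
      simp [Sequent.params, ctxParams_cons, ctxParams_singleton, Fml.params, Tm.params,
        Tm.bind, eq_params h, eq_params h'])) hΓ (by simpa using ⟨h, h'⟩)

/-- Leibniz's law for simultaneous substitutions. -/
theorem bind_imp_bind {k : ℕ} (hΓ : ctxParams Γ ⊆ soleActive n) (A : Fml k)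
    {ρ ρ' : Param → Tm 0} {σ σ' : Fin k → Tm 0}
    (hρ : ∀ p ∈ A.params, Mv n ⟨Γ, {.eq (ρ p) (ρ' p)}⟩)
    (hσ : ∀ i, Mv n ⟨Γ, {.eq (σ i) (σ' i)}⟩) :
    Mv n ⟨A.bind ρ σ ::ₘ Γ, {A.bind ρ' σ'}⟩ := by
  have good : ∀ {k : ℕ} (A : Fml k) {ρ ρ' : Param → Tm 0} {σ σ' : Fin k → Tm 0},
      (∀ p ∈ A.params, Mv n ⟨Γ, {.eq (ρ p) (ρ' p)}⟩) → (∀ i, Mv n ⟨Γ, {.eq (σ i) (σ' i)}⟩) →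
      (A.bind ρ σ).params ⊆ soleActive n ∧ (A.bind ρ' σ').params ⊆ soleActive n :=
    fun A _ _ _ _ hρ hσ =>
      ⟨Fml.params_bind_subset (fun p hp => (eq_params (hρ p hp)).1) fun i => (eq_params (hσ i)).1,
        Fml.params_bind_subset (fun p hp => (eq_params (hρ p hp)).2) fun i => (eq_params (hσ i)).2⟩
  have h₀ : ctxParams 0 ⊆ soleActive n := by simp [ctxParams_zero]
  have hc : ∀ {A : Fml 0} {Γ : Multiset (Fml 0)}, A.params ⊆ soleActive n →
    ctxParams Γ ⊆ soleActive n → ctxParams (A ::ₘ Γ) ⊆ soleActive n := LKClosed.cons_params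
  induction A generalizing ρ ρ' with
  | eq s t =>
    obtain ⟨h₁, h₂⟩ := good _ hρ hσ
    have hs := bind_eq_bind hΓ s (fun p hp => hρ p (.inl hp)) hσ
    have ht := bind_eq_bind hΓ t (fun p hp => hρ p (.inr hp)) hσ
    refine closed.apply (init (.inr (.eq (s.bind ρ σ) (t.bind ρ σ) _ _)) ?_) (hc h₁ hΓ) fun B hB => ?_
    rotate_left
    · rcases Multiset.mem_cons.1 hB with rfl | hB
      · exact closed.weakL h₁ hs
      rcases Multiset.mem_cons.1 hB with rfl | hB
      · exact closed.weakL h₁ ht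
      rcases Multiset.mem_cons.1 hB with rfl | hB
      · exact closed.assumption (Multiset.mem_cons_self _ _) (hc h₁ hΓ)
      · cases hB
    · simp [Sequent.params, ctxParams_cons, ctxParams_singleton, Fml.params, Fml.bind,
        eq_params hs, eq_params ht]
  | neg A ih =>
    obtain ⟨h₁, h₂⟩ := good _ hρ hσ
    -- Negation is contravariant, so the induction hypothesis is used with the two substitutions
    -- exchanged; the same happens in the premise of an implication.
    have h := ih (fun p hp => symm (hρ p hp)) (fun i => symm (hσ i))
    have h' := closed.step₁ (.negL _ _ 0 : LKStep _ _ [_] ⟨(A.bind ρ σ).neg ::ₘ _, 0⟩)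
      (hc h₁ (closed.ante_params h)) h₀ h
    rw [Multiset.cons_swap] at h'
    exact closed.step₁ (.negR _ _ 0) (hc h₁ hΓ) (hc h₂ h₀) h'
  | and A B ihA ihB =>
    obtain ⟨h₁, h₂⟩ := good _ hρ hσ
    have hA := ihA (fun p hp => hρ p (.inl hp)) hσ
    have hB := ihB (fun p hp => hρ p (.inr hp)) hσ
    exact closed.step₂ (.andR _ _ _ 0) (hc h₁ hΓ) (hc h₂ h₀)
      (closed.step₁ (.andL₁ _ _ _ _) (hc h₁ hΓ) (closed.succ_params hA) hA)
      (closed.step₁ (.andL₂ _ _ _ _) (hc h₁ hΓ) (closed.succ_params hB) hB)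
  | or A B ihA ihB =>
    obtain ⟨h₁, h₂⟩ := good _ hρ hσ
    have hA := ihA (fun p hp => hρ p (.inl hp)) hσ
    have hB := ihB (fun p hp => hρ p (.inr hp)) hσ
    exact closed.step₂ (.orL _ _ _ _) (hc h₁ hΓ) (hc h₂ h₀)
      (closed.step₁ (.orR₁ _ _ _ 0) (closed.ante_params hA) (hc h₂ h₀) hA)
      (closed.step₁ (.orR₂ _ _ _ 0) (closed.ante_params hB) (hc h₂ h₀) hB)
  | imp A B ihA ihB =>
    obtain ⟨h₁, h₂⟩ := good _ hρ hσ
    have hA := ihA (fun p hp => symm (hρ p (.inl hp))) fun i => symm (hσ i)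
    have hB := ihB (fun p hp => hρ p (.inr hp)) hσ
    have hΓ' := closed.ante_params hA
    have hB' := closed.succ_params hB
    have h := closed.step₂ (.impL (A.bind ρ σ) (B.bind ρ σ) _ 0 _ _)
      (hc h₁ (by rw [ctxParams_add]; exact Set.union_subset hΓ' hΓ)) (by rwa [zero_add]) hA hB
    refine closed.step₁ (.impR _ _ _ 0) (hc h₁ hΓ) (hc h₂ h₀) ?_
    rw [zero_add] at h
    refine closed.mono (fun C hC => ?_) (Multiset.Subset.refl _)
      (hc (closed.head_ante_params hA) (hc h₁ hΓ)) hB' h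
    simp only [Multiset.mem_cons, Multiset.mem_add, Fml.bind] at hC ⊢
    tauto
  | all A ih =>
    obtain ⟨h₁, h₂⟩ := good _ hρ hσ
    obtain ⟨i, hi⟩ := exists_fresh_passive ((finite_ctxParams ((A.all.bind ρ σ) ::ₘ Γ)).union
      (A.all.bind ρ' σ').finite_params)
    simp only [Set.mem_union, not_or] at hi
    -- Both sides are opened with the same fresh passive parameter, which is admissible both as a
    -- quantified term and as an eigenvariable.
    have h := ih (σ := Fin.cases (.param (.passive i)) σ)
      (σ' := Fin.cases (.param (.passive i)) σ') hρ fun j => by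
        cases j using Fin.cases with
        | zero => exact refl hΓ ((Tm.isPassive_param i).params_subset n)
        | succ j => exact hσ j
    rw [← Fml.inst_bind, ← Fml.inst_bind] at h
    exact closed.step₁ (.allR _ (.passive i) _ 0 ⟨i, rfl⟩ hi.2 hi.1 (by simp [ctxParams_zero]))
      (hc h₁ hΓ) (hc h₂ h₀)
      (closed.step₁ (.allL _ _ _ _ (Tm.isPassive_param i)) (hc h₁ hΓ) (closed.succ_params h) h)
  | ex A ih =>
    obtain ⟨h₁, h₂⟩ := good _ hρ hσ
    obtain ⟨i, hi⟩ := exists_fresh_passive ((finite_ctxParams {A.ex.bind ρ' σ'}).union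
      ((A.ex.bind ρ σ).finite_params.union (finite_ctxParams Γ)))
    simp only [Set.mem_union, not_or] at hi
    have h := ih (σ := Fin.cases (.param (.passive i)) σ)
      (σ' := Fin.cases (.param (.passive i)) σ') hρ fun j => by
        cases j using Fin.cases with
        | zero => exact refl hΓ ((Tm.isPassive_param i).params_subset n)
        | succ j => exact hσ j
    rw [← Fml.inst_bind, ← Fml.inst_bind] at h
    exact closed.step₁ (.exL _ (.passive i) _ _ ⟨i, rfl⟩ hi.2.1 hi.2.2 hi.1)
      (hc h₁ hΓ) (hc h₂ h₀)
      (closed.step₁ (.exR _ _ _ 0 (Tm.isPassive_param i)) (closed.ante_params h) (hc h₂ h₀) h)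

/-! ### Translation of **PA**-proofs. -/

open Classical in
/-- A fresh passive parameter may be replaced by an arbitrary term. -/
theorem subst_of_update {S : Sequent} {ρ : Param → Tm 0} {p : Param} {i : ℕ}
    (hρ : ∀ r, (ρ r).params ⊆ soleActive n) (hi : Param.passive i ∉ (S.subst ρ).params)
    (hi' : Param.passive i ∉ (ρ p).params)
    (d : Mv n (S.subst (update ρ p (.param (.passive i))))) : Mv n (S.subst ρ) := by
  set ρ' := update ρ p (.param (.passive i)) with hρ'
  have hS := Sequent.params_subst_subset (S := S) hρ
  have hS' := d.2
  rw [Sequent.params, Set.union_subset_iff] at hS hS'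
  have hinst : (Fml.eq (.bvar 0) (ρ p).lift).inst (.param (.passive i)) =
      .eq (.param (.passive i)) (ρ p) := by
    simp [Fml.inst, Fml.bind, Tm.bind, PA.bind_lift_id]
  have hE : (Fml.eq (.param (.passive i)) (ρ p)).params ⊆ soleActive n :=
    Set.union_subset ((Tm.isPassive_param i).params_subset n) (hρ p)
  have hΓ : ctxParams {Fml.eq (.param (.passive i)) (ρ p)} ⊆ soleActive n := by
    rwa [ctxParams_singleton]
  -- The two substitutions differ only at `p`, where the assumed equation identifies their values.
  have heq : ∀ r, Mv n ⟨{.eq (.param (.passive i)) (ρ p)}, {.eq (ρ' r) (ρ r)}⟩ := fun r => by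
    by_cases hr : r = p
    · subst hr
      rw [hρ', update_self]
      exact closed.assumption (Multiset.mem_singleton_self _) hΓ
    · rw [hρ', update_of_ne hr]
      exact refl hΓ (hρ r)
  -- By Leibniz's law each formula of the given sequent can be cut against its counterpart under
  -- `ρ`, at the price of the equation as an extra assumption.
  have key : Mv n ⟨.eq (.param (.passive i)) (ρ p) ::ₘ ctxSubst ρ S.ante, ctxSubst ρ S.succ⟩ := by
    have hΓS := LKClosed.cons_params hE hS.1
    refine closed.cut_ante (Θ := ctxSubst ρ' S.ante) (fun A hA => ?_)
      (closed.cut_succ (Θ := ctxSubst ρ' S.succ) (fun A hA => ?_) ?_)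
    · obtain ⟨B, hB, rfl⟩ := Multiset.mem_map.1 hA
      have hB' : B.subst ρ ∈ ctxSubst ρ S.ante := Multiset.mem_map_of_mem _ hB
      refine closed.mono (fun C hC => ?_) (by simp) hΓS
        (LKClosed.cons_params (fun q hq => hS'.1 ⟨_, hA, hq⟩) hS.2)
        (bind_imp_bind (σ := Tm.bvar) (σ' := Tm.bvar) hΓ B (fun r _ => symm (heq r)) fun j => j.elim0)
      rcases Multiset.mem_cons.1 hC with rfl | hC
      · exact Multiset.mem_cons_of_mem hB'
      · exact Multiset.mem_cons.2 (.inl (Multiset.mem_singleton.1 hC))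
    · obtain ⟨B, hB, rfl⟩ := Multiset.mem_map.1 hA
      have hB' : B.subst ρ ∈ ctxSubst ρ S.succ := Multiset.mem_map_of_mem _ hB
      refine closed.mono (fun C hC => ?_) (by simpa using hB')
        (LKClosed.cons_params (fun q hq => hS'.2 ⟨_, hA, hq⟩)
          (by rw [ctxParams_add]; exact Set.union_subset hS'.1 hΓS)) hS.2
        (bind_imp_bind (σ := Tm.bvar) (σ' := Tm.bvar) hΓ B (fun r _ => heq r) fun j => j.elim0)
      simp only [Multiset.mem_cons, Multiset.mem_add, Multiset.mem_singleton] at hC ⊢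
      tauto
    · refine closed.mono (fun C hC => ?_) (fun C hC => ?_)
        (by rw [ctxParams_add]; exact Set.union_subset hS'.1 hΓS)
        (by rw [ctxParams_add]; exact Set.union_subset hS'.2 hS.2) d
      · exact Multiset.mem_add.2 (.inl hC)
      · exact Multiset.mem_add.2 (.inl hC)
  -- The fresh parameter now occurs only in the equation, so the equation can be quantified
  -- existentially and cut away.
  have hx := ex_eq (hρ p)
  refine closed.cut (A := .ex (.eq (.bvar 0) (ρ p).lift)) ?_ ?_
  · exact closed.mono (by simp) (by simp) hS.1
      (LKClosed.cons_params (closed.head_succ_params hx) hS.2) hx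
  · refine closed.step₁ (.exL _ (.passive i) _ _ ⟨i, rfl⟩ ?_ (fun h => hi (.inl h))
      fun h => hi (.inr h)) (LKClosed.cons_params (closed.head_succ_params hx) hS.1) hS.2
      (by rwa [hinst])
    simpa [Fml.params, Tm.params, Tm.params_lift] using hi'

-- Passive values make every instantiated quantifier term passive and keep the active parameter `n`
-- out of the sequent, so that it is available as the induction variable of each induction in the
-- proof.
open Classical in
theorem passive_subst {S : Sequent} (d : PAProof S) {ρ : Param → Tm 0}
    (hρ : ∀ p, (ρ p).IsPassive) : Mv n (S.subst ρ) := by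
  have hS : ∀ (S : Sequent) {ρ : Param → Tm 0}, (∀ p, (ρ p).IsPassive) →
      (S.subst ρ).params ⊆ soleActive n := fun S _ hρ =>
    Sequent.params_subst_subset fun p => (hρ p).params_subset n
  have hup : ∀ {ρ : Param → Tm 0}, (∀ p, (ρ p).IsPassive) → ∀ p i,
      ∀ r, (update ρ p (.param (.passive i)) r).IsPassive := fun hρ p i r => by
    by_cases hr : r = p
    · subst hr
      rw [update_self]
      exact Tm.isPassive_param i
    · rw [update_of_ne hr]
      exact hρ r
  induction d generalizing ρ with
  | logical A =>
    exact closed.logical _ (Fml.params_bind_subset (fun p _ => (hρ p).params_subset n)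
      fun j => j.elim0)
  | init h => exact init (.inl (h.subst ρ)) (hS _ hρ)
  | @lk Ps S h d ih =>
    obtain ⟨ρ', hρ', h'⟩ := h.subst (E' := fun p => ∃ i, p = .passive i) (I' := Tm.IsPassive)
      (K := fun ρ => ∀ p, (ρ p).IsPassive)
      (fun s hs => (exists_fresh_passive hs).elim fun i hi =>
        ⟨_, hi, ⟨i, rfl⟩, fun _ hρ p => hup hρ p i⟩)
      (fun ρ hρ t _ p hp => by
        rcases Tm.mem_params_bind hp with ⟨q, -, hq⟩ | ⟨j, -⟩
        exacts [hρ q p hq, j.elim0]) hρ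
    refine closed.step (hS _ hρ) h' fun P hP => ?_
    obtain ⟨Q, hQ, rfl⟩ := List.mem_map.1 hP
    exact ih Q hQ hρ'
  | ind F a t Γ Δ hF hΓ hΔ d ih =>
    have hna : ∀ p, Param.active n ∉ (ρ p).params := fun p h => by
      obtain ⟨i, hi⟩ := hρ p _ h
      cases hi
    have hna' : ∀ Γ, Param.active n ∉ ctxParams (ctxSubst ρ Γ) := fun Γ h =>
      (mem_ctxParams_subst h).elim fun q hq => hna q hq.2
    set ρ' := update ρ a (.param (.active n)) with hρ'
    obtain ⟨i, hi⟩ := exists_fresh_passive (Sequent.finite_params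
      (Sequent.subst ⟨F.inst (.param a) ::ₘ Γ, F.inst (Tm.succ (.param a)) ::ₘ Δ⟩ ρ'))
    -- The second update overrides the first, so the induction hypothesis is needed only for a
    -- passive substitution; the passive parameter is afterwards exchanged for the active one.
    have h := subst_of_update (p := a) (i := i) (fun r => ?_) hi ?_
      (by rw [hρ', update_idem]; exact ih (hup hρ a i))
    · simp only [Sequent.subst, ctxSubst_cons, Fml.inst_subst, Tm.bind, hρ',
        update_self, ctxSubst_update hΓ, ctxSubst_update hΔ, Fml.subst₁_update hF] at h ⊢
      refine ind (fun p hp => ?_) (fun h => ?_) (hna' Γ) (hna' Δ) h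
      · rcases Tm.mem_params_bind hp with ⟨q, -, hq⟩ | ⟨j, -⟩
        exacts [(hρ q).params_subset n hq, j.elim0]
      · exact (Fml.mem_params_subst₁ h).elim fun q hq => hna q hq.2
    · by_cases hr : r = a
      · subst hr
        rw [hρ', update_self]
        exact Set.singleton_subset_iff.2 (active_mem_soleActive n)
      · rw [hρ', update_of_ne hr]
        exact (hρ r).params_subset n
    · rw [hρ', update_self]
      exact fun h => nomatch h

-- Induction on a finite set outside of which the substitution is passive: each step makes one more
-- value passive and then restores it by `subst_of_update`.
open Classical in
theorem of_PA {S : Sequent} (hS : S.params ⊆ soleActive n) (d : PAProof S) : Mv n S := by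
  have key : ∀ T : Set Param, T.Finite → ∀ ρ : Param → Tm 0,
      (∀ p, (ρ p).params ⊆ soleActive n) → (∀ p ∉ T, (ρ p).IsPassive) → Mv n (S.subst ρ) := by
    intro T hT
    induction T, hT using Set.Finite.induction_on with
    | empty => exact fun ρ _ h => passive_subst d fun p => h p (Set.notMem_empty p)
    | @insert p T _ _ ih =>
      intro ρ hρ hT
      obtain ⟨i, hi⟩ := exists_fresh_passive ((S.subst ρ).finite_params.union (ρ p).finite_params)
      simp only [Set.mem_union, not_or] at hi
      refine subst_of_update (p := p) hρ hi.1 hi.2 (ih _ (fun r => ?_) fun r hr => ?_) <;>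
        by_cases hrp : r = p
      · subst hrp
        rw [update_self]
        exact (Tm.isPassive_param i).params_subset n
      · rw [update_of_ne hrp]
        exact hρ r
      · subst hrp
        rw [update_self]
        exact Tm.isPassive_param i
      · rw [update_of_ne hrp]
        exact hT r fun h => h.elim hrp hr
  -- The substitution is the identity on the sequent. Elsewhere the value `0` removes other active
  -- parameters and is passive because it has no parameters.
  have h := key S.params S.finite_params (fun p => if p ∈ S.params then .param p else .zero)
    (fun p => ?_) fun p hp => ?_
  · rwa [Sequent.subst_congr (ρ' := Tm.param) fun p hp => if_pos hp, Sequent.subst_id] at h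
  · split_ifs with hp
    · exact Set.singleton_subset_iff.2 (hS hp)
    · exact Set.empty_subset _
  · rw [if_neg hp]
    exact fun _ h => h.elim

end Mv

end PASchema

theorem mainTheorem1 (S : PASchema.Sequent) (hS : S.IsSchematic) :
    (∃ d : PASchema.MvLKIE S, d.EFree) ↔ Nonempty (PASchema.PAProof S) := by
  constructor
  · rintro ⟨d, hd⟩
    exact PASchema.PA.of_mvLKIE d hd
  · rintro ⟨d⟩
    obtain ⟨n, hn⟩ := hS.exists_subset
    exact (PASchema.Mv.of_PA hn d).1
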